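/- **Corollary 3 (Compositional).** There are $m\ge 1$ clients. Client $i$ has sampled outer objectives $f_i(y;\xi)$, $\xi\sim\mathcal C_i$, with $y\in\mathbb R^{d_2}$, and sampled inner maps $r_i(x;\zeta)\in\mathbb R^{d_2}$, $\zeta\sim\mathcal D_i$, with $x\in\mathbb R^{d_1}$. The federated compositional problem is $$\min_{x}\ f(x)=\frac1m\sum_{i=1}^m f_i(y^*(x)),\qquad y^*(x)\in\arg\min_{y}\frac1m\sum_{i=1}^m \mathbb E_{\zeta\sim\mathcal D_i}\,g_i(x,y;\zeta),\qquad g_i(x,y;\zeta)=\tfrac12\|y-r_i(x;\zeta)\|^2,$$ where $f_i(y)=\mathbb E_{\xi\sim\mathcal C_i}f_i(y;\xi)$; put $r_i(x)=\mathbb E_{\zeta\sim\mathcal D_i}r_i(x;\zeta)$. *Assumptions.* For all $i$: $f_i,\nabla f_i,r_i,\nabla r_i$ are Lipschitz with constants $\ell_{f,0},\ell_{f,1},\ell_{r,0},\ell_{r,1}$; the samples are differentiable (and jointly measurable) and $\nabla f_i(y;\xi)$, $r_i(x;\zeta)$, $\nabla r_i(x;\zeta)$ are unbiased estimators of $\nabla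 f_i(y)$, $r_i(x)$, $\nabla r_i(x)$ with variances at most $\sigma_f^2,\sigma_{r,0}^2,\sigma_{r,1}^2$ (spectral norm for matrices). The objective $f$ is bounded below. *Algorithm (FedNest with $T=1$).* Client $i$ makes $\tau_i\ge1$ local steps with step sizes $\alpha_i=\alpha/\tau_i$ and $\beta_i=\beta/\tau_i$. Start at deterministic $(x^0,y^0)$. Round $k=0,\dots,K-1$, starting from $(x,y)=(x^k,y^k)$, all samples being fresh: 1. (FedInn) $q=\frac1m\sum_i\nabla_y g_i(x,y;\zeta_i)$; each client starts at $y_{i,0}=y$ and iterates $y_{i,\nu+1}=y_{i,\nu}-\beta_i\big(\nabla_y g_i(x,y_{i,\nu};\zeta_{i,\nu})-\nabla_y g_i(x,y;\zeta_{i,\nu})+q\big)$; $y^{k+1}=y^+=\frac1m\sum_i y_{i,\tau_i}$. 2. (FedIHGP, with parameter $N\ge1$ and inner smoothness constant $\ell_{g,1}=1$) $N'$ is uniform on $\{0,\dots,N-1\}$, $S_0,S_1,\dots$ are random non-empty client sets, uniformly distributed given their sizes, $p_0=\frac{N}{|S_0|}\sum_{i\in S_0}\nabla_y f_i(y^+;\xi_{i,0})$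 and $p_n=\frac1{|S_n|}\sum_{i\in S_n}\big(I-\nabla_y^2g_i(x,y^+;\zeta_{i,n})\big)p_{n-1}$. 3. (FedOut) $h=\frac1m\sum_i\big(-\nabla^2_{xy}g_i(x,y^+;\zeta_i)\,p_{N'}\big)$; each client starts at $x_{i,0}=x$ and iterates $x_{i,\nu+1}=x_{i,\nu}-\alpha_i h$ (the direct gradient $\nabla_x f_i$ vanishes); $x^{k+1}=\frac1m\sum_i x_{i,\tau_i}$. All draws (samples, indices $N'$, client sets, over all rounds) are mutually independent. *Conclusion.* There are $\bar\alpha_1,\bar\alpha_2,\bar\alpha_3,\bar\beta>0$, depending only on $\ell_{f,0},\ell_{f,1},\ell_{r,0},\ell_{r,1},\sigma_f,\sigma_{r,0},\sigma_{r,1}$ and $N$, such that for every $\bar\alpha>0$ and all $\Delta,R$ there is a constant $c$, depending only on these and on $\bar\alpha,\Delta,R$, with the following property. For every such problem and every such choice of $\tau_i$ and of $(x^0,y^0)$ with $f(x^0)-\inf f\le\Delta$ and $\|y^0-y^*(x^0)\|\le R$, the function $f$ is differentiable, and for every $K\ge1$ the iterates of FedNest with $T=1$ and, in every round, $$\alpha=\min\Big\{\bar\alpha_1,\bar\alpha_2,\bar\alpha_3,\frac{\bar\alpha}{\sqrt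 K}\Big\},\qquad \beta=\bar\beta\,\alpha$$ satisfy $$\frac1K\sum_{k=1}^K\mathbb E\big[\|\nabla f(x^k)\|^2\big]\le\frac{c}{\sqrt K},$$ the expectations being finite. -/

import Mathlib

open MeasureTheory ProbabilityTheory
open scoped NNReal

noncomputable section

/-- The Euclidean space `ℝ^d`. -/
abbrev Vec (d : ℕ) : Type := EuclideanSpace ℝ (Fin d)

/-! ## Federated bilevel problems -/

/-- Sampled objectives of a federated bilevel problem with `m` clients:
`f i x y ξ` is the outer and `g i x y ζ` the inner sampled objective of client `i`. -/
structure BilevelProblem (m d₁ d₂ : ℕ) (Ξ Z : Type*) where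
  f : Fin m → Vec d₁ → Vec d₂ → Ξ → ℝ
  g : Fin m → Vec d₁ → Vec d₂ → Z → ℝ

namespace BilevelProblem

variable {m d₁ d₂ : ℕ} {Ξ Z : Type*}

/-- `∇ₓ fᵢ(x, y; ξ)`. -/
def gradXf (P : BilevelProblem m d₁ d₂ Ξ Z) (i : Fin m) (x : Vec d₁) (y : Vec d₂) (ξ : Ξ) :
    Vec d₁ :=
  gradient (fun x' => P.f i x' y ξ) x

/-- `∇_y fᵢ(x, y; ξ)`. -/
def gradYf (P : BilevelProblem m d₁ d₂ Ξ Z) (i : Fin m) (x : Vec d₁) (y : Vec d₂) (ξ : Ξ) :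
    Vec d₂ :=
  gradient (fun y' => P.f i x y' ξ) y

/-- `∇_y gᵢ(x, y; ζ)`. -/
def gradYg (P : BilevelProblem m d₁ d₂ Ξ Z) (i : Fin m) (x : Vec d₁) (y : Vec d₂) (ζ : Z) :
    Vec d₂ :=
  gradient (fun y' => P.g i x y' ζ) y

/-- The Hessian `∇²_y gᵢ(x, y; ζ)`. -/
def hessYg (P : BilevelProblem m d₁ d₂ Ξ Z) (i : Fin m) (x : Vec d₁) (y : Vec d₂) (ζ : Z) :
    Vec d₂ →L[ℝ] Vec d₂ :=
  fderiv ℝ (fun y' => P.gradYg i x y' ζ) y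

/-- The mixed derivative `∇²_{xy} gᵢ(x, y; ζ)`, a `d₁ × d₂` matrix: the transpose of the
derivative of `x ↦ ∇_y gᵢ(x, y; ζ)`. -/
def jacXYg (P : BilevelProblem m d₁ d₂ Ξ Z) (i : Fin m) (x : Vec d₁) (y : Vec d₂) (ζ : Z) :
    Vec d₂ →L[ℝ] Vec d₁ :=
  ContinuousLinearMap.adjoint (fderiv ℝ (fun x' => P.gradYg i x' y ζ) x)

/-- The global inner objective `(1/m) ∑ᵢ E_{ζ ∼ Dᵢ} gᵢ(x, y; ζ)`. -/
def innerObjective [MeasurableSpace Z] (P : BilevelProblem m d₁ d₂ Ξ Z)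
    (D : Fin m → Measure Z) (x : Vec d₁) (y : Vec d₂) : ℝ :=
  (m : ℝ)⁻¹ * ∑ i, ∫ ζ, P.g i x y ζ ∂(D i)

/-- The set of global minimizers `argmin_y (1/m) ∑ᵢ gᵢ(x, y)`. -/
def innerArgmin [MeasurableSpace Z] (P : BilevelProblem m d₁ d₂ Ξ Z)
    (D : Fin m → Measure Z) (x : Vec d₁) : Set (Vec d₂) :=
  {y | ∀ y', P.innerObjective D x y ≤ P.innerObjective D x y'}

/-- The outer objective `f(x) = (1/m) ∑ᵢ E_{ξ ∼ Cᵢ} fᵢ(x, y*(x); ξ)`. -/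
def objective [MeasurableSpace Ξ] (P : BilevelProblem m d₁ d₂ Ξ Z)
    (C : Fin m → Measure Ξ) (ystar : Vec d₁ → Vec d₂) (x : Vec d₁) : ℝ :=
  (m : ℝ)⁻¹ * ∑ i, ∫ ξ, P.f i x (ystar x) ξ ∂(C i)

end BilevelProblem

/-! ## The random draws of FedNest -/

/-- The places where FedNest draws a fresh inner sample `ζ`, with the client that draws it:
outer round `k`, inner round `t`, client `i`, local step `ν`, recursion step `n`. -/
inductive InnerSlot (m : ℕ) : Type
  | innStart (k t : ℕ) (i : Fin m)
  | innLocal (k t : ℕ) (i : Fin m) (ν : ℕ)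
  | outStart (k : ℕ) (i : Fin m)
  | ihgp (k : ℕ) (i : Fin m) (n : ℕ)

/-- The client that draws the sample. -/
def InnerSlot.client {m : ℕ} : InnerSlot m → Fin m
  | .innStart _ _ i => i
  | .innLocal _ _ i _ => i
  | .outStart _ i => i
  | .ihgp _ i _ => i

/-- The places where FedNest draws a fresh outer sample `ξ`. -/
inductive OuterSlot (m : ℕ) : Type
  | outStart (k : ℕ) (i : Fin m)
  | outLocal (k : ℕ) (i : Fin m) (ν : ℕ)
  | ihgp (k : ℕ) (i : Fin m)

/-- The client that draws the sample. -/
def OuterSlot.client {m : ℕ} : OuterSlot m → Fin m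
  | .outStart _ i => i
  | .outLocal _ i _ => i
  | .ihgp _ i => i

/-- One realization of everything random in a run of FedNest: all inner and outer samples,
the random index `N'` of outer round `k`, and the random client set `Sₙ` of outer round `k`. -/
structure Draws (m : ℕ) (Ξ Z : Type*) where
  zeta : InnerSlot m → Z
  xi : OuterSlot m → Ξ
  nPrime : ℕ → ℕ
  clients : ℕ → ℕ → Finset (Fin m)

/-- The random draws `W : Ω → Draws` are those of FedNest: each sample of client `i` has law `Dᵢ`
(inner) or `Cᵢ` (outer), `N'` is uniform on `{0, …, N - 1}`, each client set is non-empty and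
uniformly random given its size (whose law is arbitrary), and all draws are mutually
independent. -/
structure IsSampling {Ω Ξ Z : Type*} [MeasurableSpace Ω] [MeasurableSpace Ξ] [MeasurableSpace Z]
    {m : ℕ} (μ : Measure Ω) (C : Fin m → Measure Ξ) (D : Fin m → Measure Z) (N : ℕ)
    (W : Ω → Draws m Ξ Z) : Prop where
  measurable_zeta : ∀ s, Measurable fun ω => (W ω).zeta s
  measurable_xi : ∀ s, Measurable fun ω => (W ω).xi s
  measurable_nPrime : ∀ k, Measurable fun ω => (W ω).nPrime k
  measurable_clients : ∀ k n A, MeasurableSet {ω | (W ω).clients k n = A}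
  law_zeta : ∀ s, μ.map (fun ω => (W ω).zeta s) = D s.client
  law_xi : ∀ s, μ.map (fun ω => (W ω).xi s) = C s.client
  law_nPrime : ∀ k, ∀ j < N, μ.real {ω | (W ω).nPrime k = j} = 1 / (N : ℝ)
  clients_nonempty : ∀ k n ω, ((W ω).clients k n).Nonempty
  law_clients : ∀ k n (A B : Finset (Fin m)), A.card = B.card →
    μ.real {ω | (W ω).clients k n = A} = μ.real {ω | (W ω).clients k n = B}
  indep : iIndep
    (Sum.elim (fun s : InnerSlot m => MeasurableSpace.comap (fun ω => (W ω).zeta s) inferInstance)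
      (Sum.elim
        (fun s : OuterSlot m => MeasurableSpace.comap (fun ω => (W ω).xi s) inferInstance)
        (Sum.elim
          (fun k : ℕ => MeasurableSpace.comap (fun ω => (W ω).nPrime k) inferInstance)
          (fun kn : ℕ × ℕ => MeasurableSpace.comap (fun ω => (W ω).clients kn.1 kn.2) ⊤)))) μ

/-! ## The algorithms -/

/-- Local iterates of FedInn at one client: `G` is the client's gradient oracle, `y` the common
starting point, `q` the averaged gradient estimate, `b` the local step size, `ζ ν` the sample of
local step `ν`. -/
def fedInnLocal {d₂ : ℕ} {Z : Type*} (G : Vec d₂ → Z → Vec d₂) (y q : Vec d₂) (b : ℝ) (ζ : ℕ → Z) :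
    ℕ → Vec d₂
  | 0 => y
  | ν + 1 =>
    fedInnLocal G y q b ζ ν -
      b • (G (fedInnLocal G y q b ζ ν) (ζ ν) - G y (ζ ν) + q)

/-- `y⁺ = FedInn(x, y, β)` in outer round `k` and inner round `t`, with `b i` the local step size
and `τ i` the number of local steps of client `i`. -/
def fedInn {m d₁ d₂ : ℕ} {Ξ Z : Type*} (P : BilevelProblem m d₁ d₂ Ξ Z) (τ : Fin m → ℕ)
    (w : Draws m Ξ Z) (k t : ℕ) (b : Fin m → ℝ) (x : Vec d₁) (y : Vec d₂) : Vec d₂ :=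
  let q : Vec d₂ := (m : ℝ)⁻¹ • ∑ i, P.gradYg i x y (w.zeta (.innStart k t i))
  (m : ℝ)⁻¹ • ∑ i,
    fedInnLocal (P.gradYg i x) y q (b i) (fun ν => w.zeta (.innLocal k t i ν)) (τ i)

/-- The vectors `pₙ` of FedIHGP at `(x, y)` in outer round `k`, where `ℓ` is the smoothness
constant of the inner objective. FedIHGP returns `p_{N'}`. -/
def fedIHGP {m d₁ d₂ : ℕ} {Ξ Z : Type*} (P : BilevelProblem m d₁ d₂ Ξ Z) (ℓ : ℝ) (N : ℕ)
    (w : Draws m Ξ Z) (k : ℕ) (x : Vec d₁) (y : Vec d₂) : ℕ → Vec d₂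
  | 0 =>
    ((N : ℝ) / ℓ) • (((w.clients k 0).card : ℝ)⁻¹ •
      ∑ i ∈ w.clients k 0, P.gradYf i x y (w.xi (.ihgp k i)))
  | n + 1 =>
    ((w.clients k (n + 1)).card : ℝ)⁻¹ • ∑ i ∈ w.clients k (n + 1),
      (fedIHGP P ℓ N w k x y n -
        ℓ⁻¹ • P.hessYg i x y (w.zeta (.ihgp k i (n + 1))) (fedIHGP P ℓ N w k x y n))

/-- Local iterates of FedOut at one client: `F` is the client's direct gradient oracle, `x` the
common starting point, `h` the averaged hypergradient estimate, `a` the local step size. -/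
def fedOutLocal {d₁ : ℕ} {Ξ : Type*} (F : Vec d₁ → Ξ → Vec d₁) (x h : Vec d₁) (a : ℝ) (ξ : ℕ → Ξ) :
    ℕ → Vec d₁
  | 0 => x
  | ν + 1 =>
    fedOutLocal F x h a ξ ν -
      a • (F (fedOutLocal F x h a ξ ν) (ξ ν) - F x (ξ ν) + h)

/-- `x⁺ = FedOut(x, y, α)` in outer round `k`, with `a i` the local step size and `τ i` the number
of local steps of client `i`. -/
def fedOut {m d₁ d₂ : ℕ} {Ξ Z : Type*} (P : BilevelProblem m d₁ d₂ Ξ Z) (ℓ : ℝ) (N : ℕ)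
    (τ : Fin m → ℕ) (w : Draws m Ξ Z) (k : ℕ) (a : Fin m → ℝ) (x : Vec d₁) (y : Vec d₂) :
    Vec d₁ :=
  let p : Vec d₂ := fedIHGP P ℓ N w k x y (w.nPrime k)
  let h : Vec d₁ := (m : ℝ)⁻¹ • ∑ i,
    (P.gradXf i x y (w.xi (.outStart k i)) - P.jacXYg i x y (w.zeta (.outStart k i)) p)
  (m : ℝ)⁻¹ • ∑ i,
    fedOutLocal (fun x' ξ => P.gradXf i x' y ξ) x h (a i) (fun ν => w.xi (.outLocal k i ν)) (τ i)

/-- The iterates `y^{k,t}` of the inner loop of FedNest in outer round `k`. -/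
def fedNestInner {m d₁ d₂ : ℕ} {Ξ Z : Type*} (P : BilevelProblem m d₁ d₂ Ξ Z) (τ : Fin m → ℕ)
    (w : Draws m Ξ Z) (k : ℕ) (b : Fin m → ℝ) (x : Vec d₁) (y : Vec d₂) : ℕ → Vec d₂
  | 0 => y
  | t + 1 => fedInn P τ w k t b x (fedNestInner P τ w k b x y t)

/-- The iterates `(x^k, y^k)` of FedNest with `T` inner rounds per outer round and local step
sizes `a k i` (outer) and `b k i` (inner). -/
def fedNest {m d₁ d₂ : ℕ} {Ξ Z : Type*} (P : BilevelProblem m d₁ d₂ Ξ Z) (ℓ : ℝ) (N T : ℕ)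
    (τ : Fin m → ℕ) (a b : ℕ → Fin m → ℝ) (x₀ : Vec d₁) (y₀ : Vec d₂) (w : Draws m Ξ Z) :
    ℕ → Vec d₁ × Vec d₂
  | 0 => (x₀, y₀)
  | k + 1 =>
    let x := (fedNest P ℓ N T τ a b x₀ y₀ w k).1
    let y := (fedNest P ℓ N T τ a b x₀ y₀ w k).2
    let y' := fedNestInner P τ w k (b k) x y T
    (fedOut P ℓ N τ w k (a k) x y', y')

/-! ## Federated compositional problems -/

/-- The compositional problem with sampled outer objectives `fᵢ(y; ξ)` and sampled inner maps
`rᵢ(x; ζ)`: the bilevel problem with `gᵢ(x, y; ζ) = ½‖y - rᵢ(x; ζ)‖²`. -/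
def compositional {m d₁ d₂ : ℕ} {Ξ Z : Type*} (f : Fin m → Vec d₂ → Ξ → ℝ)
    (r : Fin m → Vec d₁ → Z → Vec d₂) : BilevelProblem m d₁ d₂ Ξ Z where
  f := fun i _ y ξ => f i y ξ
  g := fun i x y ζ => (1 / 2 : ℝ) * ‖y - r i x ζ‖ ^ 2

/-- The standing assumptions on a federated compositional problem. With `fᵢ(y) = E fᵢ(y; ξ)` and
`rᵢ(x) = E rᵢ(x; ζ)`: the functions `fᵢ, ∇fᵢ, rᵢ, ∇rᵢ` are Lipschitz, and the sampled `∇fᵢ, rᵢ, ∇rᵢ`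
are unbiased estimators with bounded variance (matrices carry the spectral norm). -/
structure CompositionalAssumptions {m d₁ d₂ : ℕ} {Ξ Z : Type*}
    [MeasurableSpace Ξ] [MeasurableSpace Z] (C : Fin m → Measure Ξ) (D : Fin m → Measure Z)
    (f : Fin m → Vec d₂ → Ξ → ℝ) (r : Fin m → Vec d₁ → Z → Vec d₂)
    (ℓf₀ ℓf₁ ℓr₀ ℓr₁ : ℝ≥0) (σf σr₀ σr₁ : ℝ) : Prop where
  prob_C : ∀ i, IsProbabilityMeasure (C i)
  prob_D : ∀ i, IsProbabilityMeasure (D i)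
  -- regularity of the samples
  differentiable_f : ∀ i ξ, Differentiable ℝ fun y => f i y ξ
  differentiable_r : ∀ i ζ, Differentiable ℝ fun x => r i x ζ
  measurable_grad_f : ∀ i, Measurable fun p : Vec d₂ × Ξ => gradient (fun y => f i y p.2) p.1
  measurable_r : ∀ i, Measurable fun p : Vec d₁ × Z => r i p.1 p.2
  measurable_deriv_r : ∀ i,
    Measurable fun p : Vec d₁ × Z => fderiv ℝ (fun x => r i x p.2) p.1
  integrable_f : ∀ i y, Integrable (f i y) (C i)
  -- well-behaved objectives
  lipschitz_f : ∀ i, LipschitzWith ℓf₀ fun y => ∫ ξ, f i y ξ ∂(C i)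
  differentiable_mean_f : ∀ i, Differentiable ℝ fun y => ∫ ξ, f i y ξ ∂(C i)
  lipschitz_grad_f : ∀ i, LipschitzWith ℓf₁ (gradient fun y => ∫ ξ, f i y ξ ∂(C i))
  lipschitz_r : ∀ i, LipschitzWith ℓr₀ fun x => ∫ ζ, r i x ζ ∂(D i)
  differentiable_mean_r : ∀ i, Differentiable ℝ fun x => ∫ ζ, r i x ζ ∂(D i)
  lipschitz_deriv_r : ∀ i, LipschitzWith ℓr₁ (fderiv ℝ fun x => ∫ ζ, r i x ζ ∂(D i))
  -- unbiasedness
  integrable_grad_f : ∀ i y, Integrable (fun ξ => gradient (fun y' => f i y' ξ) y) (C i)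
  unbiased_grad_f : ∀ i y, ∫ ξ, gradient (fun y' => f i y' ξ) y ∂(C i) =
    gradient (fun y' => ∫ ξ, f i y' ξ ∂(C i)) y
  integrable_r : ∀ i x, Integrable (r i x) (D i)
  integrable_deriv_r : ∀ i x, Integrable (fun ζ => fderiv ℝ (fun x' => r i x' ζ) x) (D i)
  unbiased_deriv_r : ∀ i x, ∫ ζ, fderiv ℝ (fun x' => r i x' ζ) x ∂(D i) =
    fderiv ℝ (fun x' => ∫ ζ, r i x' ζ ∂(D i)) x
  -- bounded variance
  integrable_sq_f : ∀ i y, Integrable (fun ξ => ‖gradient (fun y' => f i y' ξ) y -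
    gradient (fun y' => ∫ ξ', f i y' ξ' ∂(C i)) y‖ ^ 2) (C i)
  variance_f : ∀ i y, ∫ ξ, ‖gradient (fun y' => f i y' ξ) y -
    gradient (fun y' => ∫ ξ', f i y' ξ' ∂(C i)) y‖ ^ 2 ∂(C i) ≤ σf ^ 2
  integrable_sq_r : ∀ i x, Integrable (fun ζ => ‖r i x ζ - ∫ ζ', r i x ζ' ∂(D i)‖ ^ 2) (D i)
  variance_r : ∀ i x, ∫ ζ, ‖r i x ζ - ∫ ζ', r i x ζ' ∂(D i)‖ ^ 2 ∂(D i) ≤ σr₀ ^ 2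
  integrable_sq_deriv_r : ∀ i x, Integrable (fun ζ => ‖fderiv ℝ (fun x' => r i x' ζ) x -
    fderiv ℝ (fun x' => ∫ ζ', r i x' ζ' ∂(D i)) x‖ ^ 2) (D i)
  variance_deriv_r : ∀ i x, ∫ ζ, ‖fderiv ℝ (fun x' => r i x' ζ) x -
    fderiv ℝ (fun x' => ∫ ζ', r i x' ζ' ∂(D i)) x‖ ^ 2 ∂(D i) ≤ σr₁ ^ 2

end

noncomputable section

/-! ## Deterministic estimates -/

section Deterministic

open scoped RealInnerProductSpace

variable {E₁ E₂ : Type*} [NormedAddCommGroup E₁] [InnerProductSpace ℝ E₁] [CompleteSpace E₁]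
  [NormedAddCommGroup E₂] [InnerProductSpace ℝ E₂] [CompleteSpace E₂]

/-! For the quadratic inner objective the whole algorithm collapses to a two-timescale stochastic
gradient method. Put F = (1/m) ∑ fᵢ and ρ = (1/m) ∑ rᵢ (`meanOuter`, `meanInner`). Completing the
square shows that the inner minimizer is y*(x) = ρ(x), so the objective is F ∘ ρ, with gradient
Dρ(x)ᵀ ∇F(ρ(x)).

In FedInn the corrected local gradient is (y_ν - y) + q, because the local sample cancels; hence y⁺
= y - s (y - r̂), where r̂ is the sampled mean of r(x) and s is the client average of 1 - (1 -
β/τᵢ)^τᵢ, which lies in [β/2, β] for β ≤ 1. In FedIHGP the inner Hessian is the identity, so pₙ = 0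
for n ≥ 1; only N' = 0 contributes, and its factor N cancels the probability 1/N. With the symmetry
of the client sets this makes p an unbiased estimate of ∇F(y⁺). In FedOut the direct gradient is
zero, so x⁺ = x - α Aᵀp, where A is a sampled Jacobian independent of p. Thus the hypergradient
estimate has mean Dρ(x)ᵀ ∇F(y⁺) and second moment at most M, by independence and second moments
alone.

The Lyapunov function is Λ(x, y) = F(ρ(x)) - flow + ‖y - ρ(x)‖². One FedOut step lowers it by (α/2)
‖∇(F ∘ ρ)(x)‖² in mean, at the cost of a factor 1 + C₁ α on the tracking error and an additive C₂ α²
(`lintegral_lyapunov_outStep_le`). The preceding FedInn step contracts the tracking error by (1 -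
s)² ≤ 1 - C₁ α as soon as β ≥ 2 C₁ α, which pays for that factor, and adds noise of order β²
(`lintegral_innStep_le`). Since β is proportional to α, telescoping bounds α/2 times the sum of the
squared gradients by the initial value of Λ plus O(K α²), and the choice of α gives the rate
(`rate_of_min_step`).

Conditioning on the past is Fubini for independent variables (`lintegral_indepFun`), applied to
half-rounds. Expectations of Λ are Lebesgue integrals of nonnegative functions, so their finiteness
need not be tracked. -/

theorem gradient_half_norm_sub_sq (c y : E₁) :
    gradient (fun y' => (1 / 2 : ℝ) * ‖y' - c‖ ^ 2) y = y - c := by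
  refine HasGradientAt.gradient ?_
  rw [hasGradientAt_iff_hasFDerivAt]
  have h := (((hasFDerivAt_id (𝕜 := ℝ) y).sub_const c).norm_sq).const_mul (1 / 2 : ℝ)
  refine h.congr_fderiv ?_
  ext v
  simp

/-- First-order Taylor estimate for a map with Lipschitz derivative. -/
theorem norm_taylor_le_of_lipschitz_fderiv {E F : Type*} [NormedAddCommGroup E] [NormedSpace ℝ E]
    [NormedAddCommGroup F] [NormedSpace ℝ F] {f : E → F} {L : ℝ} (hL : 0 ≤ L)
    (hf : Differentiable ℝ f) (hf' : ∀ x y, ‖fderiv ℝ f x - fderiv ℝ f y‖ ≤ L * ‖x - y‖) (x d : E) :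
    ‖f (x + d) - f x - fderiv ℝ f x d‖ ≤ L * ‖d‖ ^ 2 := by
  have h := Convex.norm_image_sub_le_of_norm_fderiv_le' (𝕜 := ℝ) (f := f) (s := segment ℝ x (x + d))
    (x := x) (y := x + d) (φ := fderiv ℝ f x) (C := L * ‖d‖) (fun z _ => hf z) ?_
    (convex_segment _ _) (left_mem_segment _ _ _) (right_mem_segment _ _ _)
  · simpa [pow_two, mul_assoc] using h
  · intro z hz
    refine (hf' z x).trans (mul_le_mul_of_nonneg_left ?_ hL)
    have := norm_sub_le_of_mem_segment hz
    simpa using this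

/-- Below: (1 - β/n)^n ≤ exp(-β) ≤ 1 - β/2 on [0, 1]. Above: Bernoulli. The bounds are free of n, so
the rate does not depend on the numbers of local steps. -/
theorem one_sub_one_sub_div_pow_mem {β : ℝ} (h0 : 0 ≤ β) (h1 : β ≤ 1) {n : ℕ} (hn : 1 ≤ n) :
    β / 2 ≤ 1 - (1 - β / n) ^ n ∧ 1 - (1 - β / n) ^ n ≤ β := by
  have hn' : (1 : ℝ) ≤ n := by exact_mod_cast hn
  have hd : β / n ≤ 1 := by rw [div_le_one (by linarith)]; linarith
  constructor
  · have h2 : (1 - β / n) ^ n ≤ Real.exp (-β) := Real.one_sub_div_pow_le_exp_neg (by linarith)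
    have h3 : Real.exp (-β) ≤ 1 - β / 2 := by
      rw [Real.exp_neg, inv_le_iff_one_le_mul₀ (Real.exp_pos _)]
      nlinarith [Real.add_one_le_exp β]
    linarith
  · have h2 := one_add_mul_le_pow (a := -(β / n)) (by linarith) n
    have h3 : (n : ℝ) * -(β / n) = -β := by field_simp
    rw [h3] at h2
    have h4 : (1 : ℝ) + -(β / n) = 1 - β / n := by ring
    rw [h4] at h2
    linarith

/-- A composition `F ∘ ρ` with bounded and Lipschitz first derivatives. -/
structure SmoothComposition (F : E₂ → ℝ) (ρ : E₁ → E₂) (a₀ a₁ b₀ b₁ : ℝ) : Prop where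
  nonneg_a₀ : 0 ≤ a₀
  nonneg_a₁ : 0 ≤ a₁
  nonneg_b₀ : 0 ≤ b₀
  nonneg_b₁ : 0 ≤ b₁
  differentiable_outer : Differentiable ℝ F
  differentiable_inner : Differentiable ℝ ρ
  norm_gradient_le : ∀ y, ‖gradient F y‖ ≤ a₀
  norm_gradient_sub_le : ∀ y y', ‖gradient F y - gradient F y'‖ ≤ a₁ * ‖y - y'‖
  norm_sub_le : ∀ x x', ‖ρ x - ρ x'‖ ≤ b₀ * ‖x - x'‖
  norm_fderiv_le : ∀ x, ‖fderiv ℝ ρ x‖ ≤ b₀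
  norm_fderiv_sub_le : ∀ x x', ‖fderiv ℝ ρ x - fderiv ℝ ρ x'‖ ≤ b₁ * ‖x - x'‖

/-! ### Gradient of F ∘ ρ and pathwise change of the Lyapunov function -/

namespace SmoothComposition

variable {F : E₂ → ℝ} {ρ : E₁ → E₂} {a₀ a₁ b₀ b₁ : ℝ}

theorem differentiable_comp (h : SmoothComposition F ρ a₀ a₁ b₀ b₁) :
    Differentiable ℝ fun x => F (ρ x) :=
  h.differentiable_outer.comp h.differentiable_inner

theorem gradient_comp (h : SmoothComposition F ρ a₀ a₁ b₀ b₁) (x : E₁) :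
    gradient (fun x => F (ρ x)) x =
      ContinuousLinearMap.adjoint (fderiv ℝ ρ x) (gradient F (ρ x)) := by
  refine HasGradientAt.gradient ?_
  rw [hasGradientAt_iff_hasFDerivAt]
  refine ((h.differentiable_outer (ρ x)).hasFDerivAt.comp x
    (h.differentiable_inner x).hasFDerivAt).congr_fderiv ?_
  ext v
  simp [ContinuousLinearMap.adjoint_inner_left, inner_gradient_left]

theorem norm_adjoint_apply_le (h : SmoothComposition F ρ a₀ a₁ b₀ b₁) (x : E₁) (v : E₂) :
    ‖ContinuousLinearMap.adjoint (fderiv ℝ ρ x) v‖ ≤ b₀ * ‖v‖ := by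
  refine (ContinuousLinearMap.le_opNorm _ _).trans ?_
  rw [LinearIsometryEquiv.norm_map]
  exact mul_le_mul_of_nonneg_right (h.norm_fderiv_le x) (norm_nonneg _)

theorem norm_gradient_comp_le (h : SmoothComposition F ρ a₀ a₁ b₀ b₁) (x : E₁) :
    ‖gradient (fun x => F (ρ x)) x‖ ≤ b₀ * a₀ := by
  rw [h.gradient_comp]
  exact (h.norm_adjoint_apply_le x _).trans
    (mul_le_mul_of_nonneg_left (h.norm_gradient_le _) h.nonneg_b₀)

theorem norm_gradient_comp_sub_le (h : SmoothComposition F ρ a₀ a₁ b₀ b₁) (x x' : E₁) :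
    ‖gradient (fun x => F (ρ x)) x - gradient (fun x => F (ρ x)) x'‖ ≤
      (b₀ ^ 2 * a₁ + b₁ * a₀) * ‖x - x'‖ := by
  rw [h.gradient_comp, h.gradient_comp]
  have e : ContinuousLinearMap.adjoint (fderiv ℝ ρ x) (gradient F (ρ x)) -
      ContinuousLinearMap.adjoint (fderiv ℝ ρ x') (gradient F (ρ x')) =
      ContinuousLinearMap.adjoint (fderiv ℝ ρ x) (gradient F (ρ x) - gradient F (ρ x')) +
      ContinuousLinearMap.adjoint (fderiv ℝ ρ x - fderiv ℝ ρ x') (gradient F (ρ x')) := by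
    rw [map_sub, map_sub, sub_apply]; abel
  rw [e]
  refine (norm_add_le _ _).trans ?_
  have h1 := h.norm_adjoint_apply_le x (gradient F (ρ x) - gradient F (ρ x'))
  have h2 := h.norm_gradient_sub_le (ρ x) (ρ x')
  have h3 := h.norm_sub_le x x'
  have h4 : ‖ContinuousLinearMap.adjoint (fderiv ℝ ρ x - fderiv ℝ ρ x') (gradient F (ρ x'))‖ ≤
      (b₁ * ‖x - x'‖) * a₀ := by
    refine (ContinuousLinearMap.le_opNorm _ _).trans ?_
    rw [LinearIsometryEquiv.norm_map]
    exact mul_le_mul (h.norm_fderiv_sub_le _ _) (h.norm_gradient_le _) (norm_nonneg _)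
      (mul_nonneg h.nonneg_b₁ (norm_nonneg _))
  have h5 : b₀ * ‖gradient F (ρ x) - gradient F (ρ x')‖ ≤ b₀ * (a₁ * (b₀ * ‖x - x'‖)) :=
    mul_le_mul_of_nonneg_left (h2.trans (mul_le_mul_of_nonneg_left h3 h.nonneg_a₁)) h.nonneg_b₀
  linarith

theorem continuous_gradient_comp (h : SmoothComposition F ρ a₀ a₁ b₀ b₁) :
    Continuous (gradient fun x => F (ρ x)) :=
  (LipschitzWith.of_dist_le_mul (K := Real.toNNReal (b₀ ^ 2 * a₁ + b₁ * a₀)) fun x x' => by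
    rw [dist_eq_norm, dist_eq_norm]
    exact (h.norm_gradient_comp_sub_le x x').trans
      (mul_le_mul_of_nonneg_right (Real.le_coe_toNNReal _) (norm_nonneg _))).continuous

theorem comp_sub_le (h : SmoothComposition F ρ a₀ a₁ b₀ b₁) (x d : E₁) :
    F (ρ (x + d)) ≤ F (ρ x) + ⟪gradient (fun x => F (ρ x)) x, d⟫ +
      (b₀ ^ 2 * a₁ + b₁ * a₀) * ‖d‖ ^ 2 := by
  have hL : 0 ≤ b₀ ^ 2 * a₁ + b₁ * a₀ :=
    add_nonneg (mul_nonneg (sq_nonneg _) h.nonneg_a₁) (mul_nonneg h.nonneg_b₁ h.nonneg_a₀)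
  have h1 := norm_taylor_le_of_lipschitz_fderiv hL h.differentiable_comp (fun x y => by
    rw [← toDual_gradient, ← toDual_gradient, ← map_sub, LinearIsometryEquiv.norm_map]
    exact h.norm_gradient_comp_sub_le x y) x d
  rw [Real.norm_eq_abs, ← inner_gradient_left] at h1
  linarith [le_abs_self (F (ρ (x + d)) - F (ρ x) - ⟪gradient (fun x => F (ρ x)) x, d⟫)]

/-- The direction whose pairing with the hypergradient estimate controls the change of the
Lyapunov function. -/
def driftDirection (F : E₂ → ℝ) (ρ : E₁ → E₂) (x : E₁) (y : E₂) : E₁ :=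
  (2 : ℝ) • ContinuousLinearMap.adjoint (fderiv ℝ ρ x) (y - ρ x) - gradient (fun x => F (ρ x)) x

/-- Second-order expansion in the step: `driftDirection` is minus the gradient in x of F(ρ(x)) + ‖y
- ρ(x)‖². The quadratic coefficient depends on the tracking error because the Taylor remainder of ρ
is paired with y - ρ(x). -/
theorem lyapunov_sub_smul_le (h : SmoothComposition F ρ a₀ a₁ b₀ b₁) (x : E₁) (y : E₂) (p : E₁)
    (α : ℝ) :
    F (ρ (x - α • p)) + ‖y - ρ (x - α • p)‖ ^ 2 ≤
      F (ρ x) + ‖y - ρ x‖ ^ 2 + α * ⟪driftDirection F ρ x y, p⟫ +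
        α ^ 2 * ((b₀ ^ 2 * a₁ + b₁ * a₀ + b₀ ^ 2 + b₁ * (1 + ‖y - ρ x‖ ^ 2)) * ‖p‖ ^ 2) := by
  have h1 := h.comp_sub_le x (-(α • p))
  rw [← sub_eq_add_neg] at h1
  have h2 := norm_taylor_le_of_lipschitz_fderiv h.nonneg_b₁ h.differentiable_inner
    h.norm_fderiv_sub_le x (-(α • p))
  rw [← sub_eq_add_neg] at h2
  have h3 := h.norm_sub_le (x - α • p) x
  have hn : ‖-(α • p)‖ ^ 2 = α ^ 2 * ‖p‖ ^ 2 := by rw [norm_neg, norm_smul, mul_pow]; simp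
  rw [hn] at h1 h2
  have hn' : x - α • p - x = -(α • p) := by abel
  rw [hn'] at h3
  set e := ρ (x - α • p) - ρ x - fderiv ℝ ρ x (-(α • p)) with he
  have h4 : ‖ρ (x - α • p) - ρ x‖ ^ 2 ≤ b₀ ^ 2 * (α ^ 2 * ‖p‖ ^ 2) := by
    rw [← hn, ← mul_pow]
    exact pow_le_pow_left₀ (norm_nonneg _) h3 2
  have h5 : ρ (x - α • p) - ρ x = e - α • fderiv ℝ ρ x p := by
    rw [he, map_neg, map_smul]; abel
  have h6 : ‖y - ρ (x - α • p)‖ ^ 2 = ‖y - ρ x‖ ^ 2 - 2 * ⟪y - ρ x, ρ (x - α • p) - ρ x⟫ +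
      ‖ρ (x - α • p) - ρ x‖ ^ 2 := by
    rw [← norm_sub_sq_real]; congr 2; abel
  have h7 : -⟪y - ρ x, e⟫ ≤ ‖y - ρ x‖ * (b₁ * (α ^ 2 * ‖p‖ ^ 2)) := by
    refine (neg_le_abs _).trans ((abs_real_inner_le_norm _ _).trans ?_)
    exact mul_le_mul_of_nonneg_left h2 (norm_nonneg _)
  -- By 2t ≤ 1 + t² the tracking error appears only squared, hence as a multiple of a term of the
  -- Lyapunov function.
  have h8 : 2 * (‖y - ρ x‖ * (b₁ * (α ^ 2 * ‖p‖ ^ 2))) ≤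
      (1 + ‖y - ρ x‖ ^ 2) * (b₁ * (α ^ 2 * ‖p‖ ^ 2)) := by
    have : 0 ≤ b₁ * (α ^ 2 * ‖p‖ ^ 2) := mul_nonneg h.nonneg_b₁ (by positivity)
    nlinarith [sq_nonneg (1 - ‖y - ρ x‖)]
  have h9 : ⟪y - ρ x, ρ (x - α • p) - ρ x⟫ = ⟪y - ρ x, e⟫ - α * ⟪y - ρ x, fderiv ℝ ρ x p⟫ := by
    rw [h5, inner_sub_right, real_inner_smul_right]
  have h10 : ⟪driftDirection F ρ x y, p⟫ = 2 * ⟪y - ρ x, fderiv ℝ ρ x p⟫ -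
      ⟪gradient (fun x => F (ρ x)) x, p⟫ := by
    rw [driftDirection, inner_sub_left, real_inner_smul_left,
      ContinuousLinearMap.adjoint_inner_left]
  rw [inner_neg_right, real_inner_smul_right] at h1
  rw [h6, h9, h10]
  nlinarith

/-- The mean hypergradient estimate is the true gradient G plus a bias e of size O(‖y - ρ(x)‖). The
pairing is -‖G‖² plus terms with a factor ‖y - ρ(x)‖. -/
theorem inner_driftDirection_le (h : SmoothComposition F ρ a₀ a₁ b₀ b₁) (x : E₁) (y : E₂) :
    ⟪driftDirection F ρ x y, ContinuousLinearMap.adjoint (fderiv ℝ ρ x) (gradient F y)⟫ ≤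
      -(1 / 2) * ‖gradient (fun x => F (ρ x)) x‖ ^ 2 +
        ((b₀ * a₁ + 2 * b₀) ^ 2 / 2 + 2 * b₀ * (b₀ * a₁)) * ‖y - ρ x‖ ^ 2 := by
  set G := gradient (fun x => F (ρ x)) x with hG
  set u := ContinuousLinearMap.adjoint (fderiv ℝ ρ x) (y - ρ x)
  set e := ContinuousLinearMap.adjoint (fderiv ℝ ρ x) (gradient F y - gradient F (ρ x)) with he
  have e1 : ContinuousLinearMap.adjoint (fderiv ℝ ρ x) (gradient F y) = G + e := by
    rw [hG, h.gradient_comp, he, map_sub]; abel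
  have hu : ‖u‖ ≤ b₀ * ‖y - ρ x‖ := h.norm_adjoint_apply_le _ _
  have hb := h.nonneg_b₀
  have ha := h.nonneg_a₁
  have he' : ‖e‖ ≤ b₀ * (a₁ * ‖y - ρ x‖) := (h.norm_adjoint_apply_le _ _).trans
    (mul_le_mul_of_nonneg_left (h.norm_gradient_sub_le _ _) hb)
  have e2 : ⟪driftDirection F ρ x y, G + e⟫ = 2 * ⟪u, G⟫ + 2 * ⟪u, e⟫ - ‖G‖ ^ 2 - ⟪G, e⟫ := by
    rw [driftDirection, inner_sub_left, real_inner_smul_left, inner_add_right, inner_add_right,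
      real_inner_self_eq_norm_sq]
    ring
  rw [e1, e2]
  have i1 : ⟪u, G⟫ ≤ b₀ * ‖y - ρ x‖ * ‖G‖ := (real_inner_le_norm _ _).trans
    (mul_le_mul_of_nonneg_right hu (norm_nonneg _))
  have i2 : ⟪u, e⟫ ≤ b₀ * ‖y - ρ x‖ * (b₀ * (a₁ * ‖y - ρ x‖)) := (real_inner_le_norm _ _).trans
    (mul_le_mul hu he' (norm_nonneg _) (by positivity))
  have i3 : -⟪G, e⟫ ≤ ‖G‖ * (b₀ * (a₁ * ‖y - ρ x‖)) := (neg_le_abs _).trans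
    ((abs_real_inner_le_norm _ _).trans (mul_le_mul_of_nonneg_left he' (norm_nonneg _)))
  -- Young's inequality spends half of ‖G‖² on the terms linear in ‖G‖.
  nlinarith [sq_nonneg (‖G‖ - (b₀ * a₁ + 2 * b₀) * ‖y - ρ x‖)]

end SmoothComposition

end Deterministic

/-! ## The compositional problem in closed form -/

section ClosedForm

variable {m d₁ d₂ : ℕ} {Ξ Z : Type*}

theorem compositional_gradXf (f : Fin m → Vec d₂ → Ξ → ℝ) (r : Fin m → Vec d₁ → Z → Vec d₂)
    (i : Fin m) (x : Vec d₁) (y : Vec d₂) (ξ : Ξ) :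
    (compositional f r).gradXf i x y ξ = 0 :=
  gradient_fun_const _ _

theorem compositional_gradYf (f : Fin m → Vec d₂ → Ξ → ℝ) (r : Fin m → Vec d₁ → Z → Vec d₂)
    (i : Fin m) (x : Vec d₁) (y : Vec d₂) (ξ : Ξ) :
    (compositional f r).gradYf i x y ξ = gradient (fun y' => f i y' ξ) y :=
  rfl

theorem compositional_gradYg (f : Fin m → Vec d₂ → Ξ → ℝ) (r : Fin m → Vec d₁ → Z → Vec d₂)
    (i : Fin m) (x : Vec d₁) (y : Vec d₂) (ζ : Z) :
    (compositional f r).gradYg i x y ζ = y - r i x ζ :=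
  gradient_half_norm_sub_sq _ _

theorem compositional_hessYg (f : Fin m → Vec d₂ → Ξ → ℝ) (r : Fin m → Vec d₁ → Z → Vec d₂)
    (i : Fin m) (x : Vec d₁) (y : Vec d₂) (ζ : Z) :
    (compositional f r).hessYg i x y ζ = ContinuousLinearMap.id ℝ _ := by
  simp only [BilevelProblem.hessYg, compositional_gradYg]
  rw [fderiv_sub_const, fderiv_fun_id]

theorem compositional_jacXYg (f : Fin m → Vec d₂ → Ξ → ℝ) (r : Fin m → Vec d₁ → Z → Vec d₂)
    (i : Fin m) (x : Vec d₁) (y : Vec d₂) (ζ : Z) :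
    (compositional f r).jacXYg i x y ζ =
      -ContinuousLinearMap.adjoint (fderiv ℝ (fun x' => r i x' ζ) x) := by
  simp only [BilevelProblem.jacXYg, compositional_gradYg]
  rw [fderiv_const_sub, map_neg]

/-- The difference of the two oracle calls with the same sample is exactly the displacement from
`y`, so local samples drop out and the recursion is linear. -/
theorem fedInnLocal_sub (r : Z → Vec d₂) (y q : Vec d₂) (b : ℝ) (ζ : ℕ → Z) (n : ℕ) :
    fedInnLocal (fun y ζ => y - r ζ) y q b ζ n = y - (1 - (1 - b) ^ n) • q := by
  induction n with
  | zero => simp [fedInnLocal]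
  | succ n ih =>
    rw [fedInnLocal, ih, pow_succ]
    module

/-- The effective step size of FedInn: the average contraction over the clients. -/
def effectiveStep (τ : Fin m → ℕ) (b : Fin m → ℝ) : ℝ :=
  (m : ℝ)⁻¹ * ∑ i, (1 - (1 - b i) ^ τ i)

/-- One round of FedInn on a compositional problem. -/
def innStep (r : Fin m → Vec d₁ → Z → Vec d₂) (s : ℝ) (x : Vec d₁) (y : Vec d₂)
    (z : Fin m → Z) : Vec d₂ :=
  y - s • (y - (m : ℝ)⁻¹ • ∑ i, r i x (z i))

/-- One round of FedOut on a compositional problem, for the client weights `c`. -/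
def outStep (f : Fin m → Vec d₂ → Ξ → ℝ) (r : Fin m → Vec d₁ → Z → Vec d₂) (α : ℝ) (x : Vec d₁)
    (y : Vec d₂) (z : Fin m → Z) (ξ : Fin m → Ξ) (c : Fin m → ℝ) : Vec d₁ :=
  x - α • ContinuousLinearMap.adjoint ((m : ℝ)⁻¹ • ∑ i, fderiv ℝ (fun x' => r i x' (z i)) x)
    (∑ i, c i • gradient (fun y' => f i y' (ξ i)) y)

/-- The weight of client `i` in the vector returned by FedIHGP on a compositional problem. -/
def ihgpWeight (N n : ℕ) (A : Finset (Fin m)) (i : Fin m) : ℝ :=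
  if n = 0 then if i ∈ A then (N : ℝ) * (A.card : ℝ)⁻¹ else 0 else 0

theorem average_const_sub {E : Type*} [AddCommGroup E] [Module ℝ E] (hm : 1 ≤ m) (y : E)
    (g : Fin m → E) : (m : ℝ)⁻¹ • ∑ i, (y - g i) = y - (m : ℝ)⁻¹ • ∑ i, g i := by
  have hm' : (m : ℝ) ≠ 0 := by positivity
  rw [Finset.sum_sub_distrib, smul_sub, Finset.sum_const, Finset.card_univ, Fintype.card_fin,
    ← Nat.cast_smul_eq_nsmul ℝ, smul_smul, inv_mul_cancel₀ hm', one_smul]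

theorem fedInn_compositional (hm : 1 ≤ m) (f : Fin m → Vec d₂ → Ξ → ℝ)
    (r : Fin m → Vec d₁ → Z → Vec d₂) (τ : Fin m → ℕ) (w : Draws m Ξ Z) (k t : ℕ) (b : Fin m → ℝ)
    (x : Vec d₁) (y : Vec d₂) :
    fedInn (compositional f r) τ w k t b x y =
      innStep r (effectiveStep τ b) x y fun i => w.zeta (.innStart k t i) := by
  have e : ∀ i, (compositional f r).gradYg i x = fun y ζ => y - r i x ζ := fun i => by
    funext y ζ; exact compositional_gradYg f r i x y ζ
  simp only [fedInn, e, fedInnLocal_sub (r _ x)]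
  rw [average_const_sub hm, ← Finset.sum_smul, smul_smul, average_const_sub hm]
  rfl

/-- With identity Hessian and `ℓ = 1`, every factor I - ∇²g of the truncated Neumann series
vanishes. -/
theorem fedIHGP_compositional_succ (f : Fin m → Vec d₂ → Ξ → ℝ)
    (r : Fin m → Vec d₁ → Z → Vec d₂) (N : ℕ) (w : Draws m Ξ Z) (k : ℕ) (x : Vec d₁) (y : Vec d₂)
    (n : ℕ) : fedIHGP (compositional f r) 1 N w k x y (n + 1) = 0 := by
  simp [fedIHGP, compositional_hessYg]

theorem fedIHGP_compositional (f : Fin m → Vec d₂ → Ξ → ℝ)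
    (r : Fin m → Vec d₁ → Z → Vec d₂) (N : ℕ) (w : Draws m Ξ Z) (k : ℕ) (x : Vec d₁) (y : Vec d₂)
    (n : ℕ) : fedIHGP (compositional f r) 1 N w k x y n =
      ∑ i, ihgpWeight N n (w.clients k 0) i • gradient (fun y' => f i y' (w.xi (.ihgp k i))) y := by
  rcases n with _ | n
  · simp [fedIHGP, ihgpWeight, compositional_gradYf, ite_smul, Finset.sum_ite_mem, Finset.smul_sum,
      smul_smul]
  · simp [fedIHGP_compositional_succ, ihgpWeight]

theorem fedOutLocal_zero (x h : Vec d₁) (a : ℝ) (ξ : ℕ → Ξ) (n : ℕ) :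
    fedOutLocal (fun _ _ => 0) x h a ξ n = x - ((n : ℝ) * a) • h := by
  induction n with
  | zero => simp [fedOutLocal]
  | succ n ih =>
    rw [fedOutLocal, ih]
    push_cast
    module

theorem fedOut_compositional (hm : 1 ≤ m) (f : Fin m → Vec d₂ → Ξ → ℝ)
    (r : Fin m → Vec d₁ → Z → Vec d₂) (N : ℕ) (τ : Fin m → ℕ) (hτ : ∀ i, 1 ≤ τ i)
    (w : Draws m Ξ Z) (k : ℕ) (α : ℝ) (x : Vec d₁) (y : Vec d₂) :
    fedOut (compositional f r) 1 N τ w k (fun i => α / τ i) x y =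
      outStep f r α x y (fun i => w.zeta (.outStart k i)) (fun i => w.xi (.ihgp k i))
        (ihgpWeight N (w.nPrime k) (w.clients k 0)) := by
  have hm' : (m : ℝ) ≠ 0 := by positivity
  have hτ' : ∀ i, (τ i : ℝ) * (α / τ i) = α := fun i => by
    have : (τ i : ℝ) ≠ 0 := by have := hτ i; positivity
    field_simp
  simp only [fedOut, compositional_gradXf, fedOutLocal_zero, hτ', fedIHGP_compositional,
    compositional_jacXYg]
  rw [Finset.sum_const, Finset.card_univ, Fintype.card_fin, ← Nat.cast_smul_eq_nsmul ℝ,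
    smul_smul, inv_mul_cancel₀ hm', one_smul, outStep]
  generalize ∑ i, ihgpWeight N (w.nPrime k) (w.clients k 0) i •
    gradient (fun y' => f i y' (w.xi (.ihgp k i))) y = p
  rw [map_smul, map_sum]
  simp

theorem fedNest_compositional_succ (hm : 1 ≤ m) (f : Fin m → Vec d₂ → Ξ → ℝ)
    (r : Fin m → Vec d₁ → Z → Vec d₂) (N : ℕ) (τ : Fin m → ℕ) (hτ : ∀ i, 1 ≤ τ i)
    (w : Draws m Ξ Z) (α : ℝ) (b : Fin m → ℝ) (x₀ : Vec d₁) (y₀ : Vec d₂) (k : ℕ) :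
    fedNest (compositional f r) 1 N 1 τ (fun _ i => α / τ i) (fun _ => b) x₀ y₀ w (k + 1) =
      let S := fedNest (compositional f r) 1 N 1 τ (fun _ i => α / τ i) (fun _ => b) x₀ y₀ w k
      let y' := innStep r (effectiveStep τ b) S.1 S.2 fun i => w.zeta (.innStart k 0 i)
      (outStep f r α S.1 y' (fun i => w.zeta (.outStart k i)) (fun i => w.xi (.ihgp k i))
        (ihgpWeight N (w.nPrime k) (w.clients k 0)), y') := by
  rw [fedNest]
  simp only [fedNestInner, fedInn_compositional hm, fedOut_compositional hm f r N τ hτ]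

theorem effectiveStep_mem (hm : 1 ≤ m) (τ : Fin m → ℕ) (hτ : ∀ i, 1 ≤ τ i) {β : ℝ} (h0 : 0 ≤ β)
    (h1 : β ≤ 1) :
    β / 2 ≤ effectiveStep τ (fun i => β / τ i) ∧ effectiveStep τ (fun i => β / τ i) ≤ β := by
  have hm' : (m : ℝ) ≠ 0 := by positivity
  have hc : ∀ a : ℝ, a = (m : ℝ)⁻¹ * ∑ _i : Fin m, a := fun a => by
    rw [Finset.sum_const, Finset.card_univ, Fintype.card_fin, nsmul_eq_mul,
      inv_mul_cancel_left₀ hm']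
  constructor
  · rw [hc (β / 2)]
    exact mul_le_mul_of_nonneg_left (Finset.sum_le_sum fun i _ =>
      (one_sub_one_sub_div_pow_mem h0 h1 (hτ i)).1) (by positivity)
  · conv_rhs => rw [hc β]
    exact mul_le_mul_of_nonneg_left (Finset.sum_le_sum fun i _ =>
      (one_sub_one_sub_div_pow_mem h0 h1 (hτ i)).2) (by positivity)

end ClosedForm

/-! ## Averages over the clients -/

section Average

variable {m d₁ d₂ : ℕ} {Ξ Z : Type*}

theorem inv_mul_sum_const_le {m : ℕ} {g : Fin m → ℝ} {a : ℝ} (hm : 1 ≤ m) (h : ∀ i, g i ≤ a) :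
    (m : ℝ)⁻¹ * ∑ i, g i ≤ a := by
  have hm' : (0 : ℝ) < m := by positivity
  rw [inv_mul_le_iff₀ hm']
  simpa using Finset.sum_le_card_nsmul Finset.univ g a fun i _ => h i

theorem norm_average_le {E : Type*} [NormedAddCommGroup E] [NormedSpace ℝ E] {g : Fin m → E}
    {a : ℝ} (hm : 1 ≤ m) (h : ∀ i, ‖g i‖ ≤ a) : ‖(m : ℝ)⁻¹ • ∑ i, g i‖ ≤ a := by
  rw [norm_smul, norm_inv, Real.norm_natCast]
  exact (mul_le_mul_of_nonneg_left (norm_sum_le _ _) (by positivity)).trans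
    (inv_mul_sum_const_le hm h)

/-- Jensen's inequality. Variances are averaged pathwise, so independence across clients is never
needed and no gain in m is claimed. -/
theorem norm_average_sq_le {E : Type*} [NormedAddCommGroup E] [NormedSpace ℝ E] (g : Fin m → E) :
    ‖(m : ℝ)⁻¹ • ∑ i, g i‖ ^ 2 ≤ (m : ℝ)⁻¹ * ∑ i, ‖g i‖ ^ 2 := by
  rcases Nat.eq_zero_or_pos m with rfl | hm
  · simp
  have hm' : (0 : ℝ) < m := by positivity
  rw [norm_smul, norm_inv, Real.norm_natCast, mul_pow]
  have h1 : ‖∑ i, g i‖ ^ 2 ≤ m * ∑ i, ‖g i‖ ^ 2 := by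
    refine (pow_le_pow_left₀ (norm_nonneg _) (norm_sum_le _ _) 2).trans ?_
    simpa using sq_sum_le_card_mul_sum_sq (s := Finset.univ) (f := fun i => ‖g i‖)
  calc (m : ℝ)⁻¹ ^ 2 * ‖∑ i, g i‖ ^ 2 ≤ (m : ℝ)⁻¹ ^ 2 * (m * ∑ i, ‖g i‖ ^ 2) := by gcongr
    _ = _ := by field_simp

/-- The mean outer objective `(1/m) ∑ᵢ E fᵢ(y; ξ)`. -/
def meanOuter [MeasurableSpace Ξ] (C : Fin m → Measure Ξ) (f : Fin m → Vec d₂ → Ξ → ℝ)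
    (y : Vec d₂) : ℝ :=
  (m : ℝ)⁻¹ * ∑ i, ∫ ξ, f i y ξ ∂(C i)

/-- The mean inner map `(1/m) ∑ᵢ E rᵢ(x; ζ)`. -/
def meanInner [MeasurableSpace Z] (D : Fin m → Measure Z) (r : Fin m → Vec d₁ → Z → Vec d₂)
    (x : Vec d₁) : Vec d₂ :=
  (m : ℝ)⁻¹ • ∑ i, ∫ ζ, r i x ζ ∂(D i)

theorem norm_gradient_le_of_lipschitz {E : Type*} [NormedAddCommGroup E] [InnerProductSpace ℝ E]
    [CompleteSpace E] {K : ℝ≥0} {F : E → ℝ} (h : LipschitzWith K F) (y : E) :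
    ‖gradient F y‖ ≤ K := by
  rw [gradient, LinearIsometryEquiv.norm_map]
  exact norm_fderiv_le_of_lipschitz ℝ h

/-! ### Smoothness of the mean maps, and the inner minimizer -/

namespace CompositionalAssumptions

variable [MeasurableSpace Ξ] [MeasurableSpace Z] {C : Fin m → Measure Ξ} {D : Fin m → Measure Z}
  {f : Fin m → Vec d₂ → Ξ → ℝ} {r : Fin m → Vec d₁ → Z → Vec d₂} {ℓf₀ ℓf₁ ℓr₀ ℓr₁ : ℝ≥0}
  {σf σr₀ σr₁ : ℝ}

theorem gradient_meanOuter (h : CompositionalAssumptions C D f r ℓf₀ ℓf₁ ℓr₀ ℓr₁ σf σr₀ σr₁)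
    (y : Vec d₂) : HasGradientAt (meanOuter C f)
      ((m : ℝ)⁻¹ • ∑ i, gradient (fun y => ∫ ξ, f i y ξ ∂(C i)) y) y := by
  rw [hasGradientAt_iff_hasFDerivAt]
  refine ((HasFDerivAt.fun_sum fun i (_ : i ∈ Finset.univ) =>
    (h.differentiable_mean_f i y).hasFDerivAt).const_mul (m : ℝ)⁻¹).congr_fderiv ?_
  rw [map_smul, map_sum]
  simp only [toDual_gradient]

theorem hasFDerivAt_meanInner (h : CompositionalAssumptions C D f r ℓf₀ ℓf₁ ℓr₀ ℓr₁ σf σr₀ σr₁)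
    (x : Vec d₁) : HasFDerivAt (meanInner D r)
      ((m : ℝ)⁻¹ • ∑ i, fderiv ℝ (fun x => ∫ ζ, r i x ζ ∂(D i)) x) x :=
  (HasFDerivAt.fun_sum fun i (_ : i ∈ Finset.univ) =>
    (h.differentiable_mean_r i x).hasFDerivAt).const_smul (m : ℝ)⁻¹

theorem smoothComposition (h : CompositionalAssumptions C D f r ℓf₀ ℓf₁ ℓr₀ ℓr₁ σf σr₀ σr₁)
    (hm : 1 ≤ m) :
    SmoothComposition (meanOuter C f) (meanInner D r) ℓf₀ ℓf₁ ℓr₀ ℓr₁ where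
  nonneg_a₀ := ℓf₀.2
  nonneg_a₁ := ℓf₁.2
  nonneg_b₀ := ℓr₀.2
  nonneg_b₁ := ℓr₁.2
  differentiable_outer y := (h.gradient_meanOuter y).differentiableAt
  differentiable_inner x := (h.hasFDerivAt_meanInner x).differentiableAt
  norm_gradient_le y := by
    rw [(h.gradient_meanOuter y).gradient]
    exact norm_average_le hm fun i => norm_gradient_le_of_lipschitz (h.lipschitz_f i) y
  norm_gradient_sub_le y y' := by
    rw [(h.gradient_meanOuter y).gradient, (h.gradient_meanOuter y').gradient, ← smul_sub,
      ← Finset.sum_sub_distrib]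
    refine norm_average_le hm fun i => ?_
    simpa only [dist_eq_norm] using (h.lipschitz_grad_f i).dist_le_mul y y'
  norm_sub_le x x' := by
    rw [meanInner, meanInner, ← smul_sub, ← Finset.sum_sub_distrib]
    refine norm_average_le hm fun i => ?_
    simpa only [dist_eq_norm] using (h.lipschitz_r i).dist_le_mul x x'
  norm_fderiv_le x := by
    rw [(h.hasFDerivAt_meanInner x).fderiv]
    exact norm_average_le hm fun i => norm_fderiv_le_of_lipschitz ℝ (h.lipschitz_r i)
  norm_fderiv_sub_le x x' := by
    rw [(h.hasFDerivAt_meanInner x).fderiv, (h.hasFDerivAt_meanInner x').fderiv, ← smul_sub,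
      ← Finset.sum_sub_distrib]
    refine norm_average_le hm fun i => ?_
    simpa only [dist_eq_norm] using (h.lipschitz_deriv_r i).dist_le_mul x x'

open scoped RealInnerProductSpace in
-- Each client's expected square expands around ρ with a cross term ⟨y - ρ, ρ - rᵢ(x)⟩; these sum to
-- zero because ρ is the mean of the rᵢ(x). The minimizer ρ and its uniqueness can be read off.
theorem innerObjective_eq (h : CompositionalAssumptions C D f r ℓf₀ ℓf₁ ℓr₀ ℓr₁ σf σr₀ σr₁)
    (hm : 1 ≤ m) (x : Vec d₁) (y : Vec d₂) :
    (compositional f r).innerObjective D x y =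
      (compositional f r).innerObjective D x (meanInner D r x) +
        1 / 2 * ‖y - meanInner D r x‖ ^ 2 := by
  have hm' : (m : ℝ) ≠ 0 := by positivity
  set ρ := meanInner D r x with hρ
  have key : ∀ i, ∫ ζ, (compositional f r).g i x y ζ ∂(D i) =
      ∫ ζ, (compositional f r).g i x ρ ζ ∂(D i) + 1 / 2 * ‖y - ρ‖ ^ 2 +
        ⟪y - ρ, ρ - ∫ ζ, r i x ζ ∂(D i)⟫ := fun i => by
    have := h.prob_D i
    have i0 : Integrable (fun ζ => ρ - r i x ζ) (D i) := (integrable_const ρ).sub (h.integrable_r i x)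
    have i1 : Integrable (fun ζ => ⟪y - ρ, ρ - r i x ζ⟫) (D i) := i0.const_inner (y - ρ)
    -- Without integrability the integral would be 0 by convention and the expansion would fail; it
    -- follows from the finite variance by recentring at the client's own mean.
    have i2 : Integrable (fun ζ => (compositional f r).g i x ρ ζ) (D i) := by
      have e : (fun ζ => (compositional f r).g i x ρ ζ) = fun ζ =>
          1 / 2 * ‖r i x ζ - ∫ ζ', r i x ζ' ∂(D i)‖ ^ 2 -
            ⟪r i x ζ - ∫ ζ', r i x ζ' ∂(D i), ρ - ∫ ζ', r i x ζ' ∂(D i)⟫ +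
              1 / 2 * ‖ρ - ∫ ζ', r i x ζ' ∂(D i)‖ ^ 2 := by
        funext ζ
        simp only [compositional]
        rw [← sub_sub_sub_cancel_right ρ (r i x ζ) (∫ ζ', r i x ζ' ∂(D i)), norm_sub_sq_real,
          real_inner_comm]
        ring
      rw [e]
      refine (((h.integrable_sq_r i x).const_mul _).sub ?_).add (integrable_const _)
      exact ((h.integrable_r i x).sub (integrable_const _)).inner_const _
    have e : (fun ζ => (compositional f r).g i x y ζ) = fun ζ =>
        ((compositional f r).g i x ρ ζ + 1 / 2 * ‖y - ρ‖ ^ 2) + ⟪y - ρ, ρ - r i x ζ⟫ := by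
      funext ζ
      simp only [compositional]
      rw [← sub_add_sub_cancel y ρ (r i x ζ), norm_add_sq_real]
      ring
    have i3 : Integrable (fun ζ => (compositional f r).g i x ρ ζ + 1 / 2 * ‖y - ρ‖ ^ 2) (D i) :=
      i2.add (integrable_const _)
    rw [e, integral_add i3 i1, integral_add i2 (integrable_const _),
      integral_inner i0,
      integral_sub (integrable_const _) (h.integrable_r i x)]
    simp
  have hsum : ∑ i, (ρ - ∫ ζ, r i x ζ ∂(D i)) = 0 := by
    rw [Finset.sum_sub_distrib, Finset.sum_const, Finset.card_univ, Fintype.card_fin,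
      ← Nat.cast_smul_eq_nsmul ℝ, hρ, meanInner, smul_smul, mul_inv_cancel₀ hm', one_smul, sub_self]
  simp only [BilevelProblem.innerObjective, key]
  rw [Finset.sum_add_distrib, Finset.sum_add_distrib, ← inner_sum, hsum, inner_zero_right]
  simp only [Finset.sum_const, Finset.card_univ, Fintype.card_fin, nsmul_eq_mul]
  field_simp
  ring

theorem eq_meanInner_of_mem_innerArgmin
    (h : CompositionalAssumptions C D f r ℓf₀ ℓf₁ ℓr₀ ℓr₁ σf σr₀ σr₁) (hm : 1 ≤ m) {x : Vec d₁}
    {y : Vec d₂} (hy : y ∈ (compositional f r).innerArgmin D x) : y = meanInner D r x := by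
  have h1 := hy (meanInner D r x)
  rw [h.innerObjective_eq hm x y] at h1
  have h2 : ‖y - meanInner D r x‖ ^ 2 ≤ 0 := by linarith
  have h3 : ‖y - meanInner D r x‖ = 0 := by nlinarith [norm_nonneg (y - meanInner D r x)]
  exact sub_eq_zero.1 (norm_eq_zero.1 h3)

theorem objective_eq (h : CompositionalAssumptions C D f r ℓf₀ ℓf₁ ℓr₀ ℓr₁ σf σr₀ σr₁)
    (hm : 1 ≤ m) {ystar : Vec d₁ → Vec d₂}
    (hy : ∀ x, ystar x ∈ (compositional f r).innerArgmin D x) :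
    (compositional f r).objective C ystar = fun x => meanOuter C f (meanInner D r x) := by
  funext x
  rw [← h.eq_meanInner_of_mem_innerArgmin hm (hy x)]
  rfl

end CompositionalAssumptions

end Average

/-! ## Moments of the stochastic estimates -/

section Moments

open scoped RealInnerProductSpace

variable {Ω : Type*} [MeasurableSpace Ω] {μ : Measure Ω}

theorem memLp_two_of_variance {Z E : Type*} [MeasurableSpace Z] [NormedAddCommGroup E]
    {ν : Measure Z} [IsProbabilityMeasure ν] {G : Z → E} {e : E} (hG : AEStronglyMeasurable G ν)
    (hsq : Integrable (fun z => ‖G z - e‖ ^ 2) ν) : MemLp G 2 ν := by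
  have h := (memLp_two_iff_integrable_sq_norm (hG.sub aestronglyMeasurable_const)).2 hsq
  simpa [Pi.add_def] using h.add (memLp_const e)

theorem integral_norm_sq_le_of_variance {Z E : Type*} [MeasurableSpace Z] [NormedAddCommGroup E]
    {ν : Measure Z} [IsProbabilityMeasure ν] {G : Z → E} {e : E} {ℓ σ : ℝ}
    (hG : AEStronglyMeasurable G ν) (hsq : Integrable (fun z => ‖G z - e‖ ^ 2) ν)
    (hvar : ∫ z, ‖G z - e‖ ^ 2 ∂ν ≤ σ ^ 2) (he : ‖e‖ ≤ ℓ) :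
    ∫ z, ‖G z‖ ^ 2 ∂ν ≤ 2 * ℓ ^ 2 + 2 * σ ^ 2 := by
  have hi : Integrable (fun z => 2 * ‖e‖ ^ 2 + 2 * ‖G z - e‖ ^ 2) ν :=
    (integrable_const _).add (hsq.const_mul 2)
  have h1 : ∫ z, ‖G z‖ ^ 2 ∂ν ≤ ∫ z, (2 * ‖e‖ ^ 2 + 2 * ‖G z - e‖ ^ 2) ∂ν := by
    refine integral_mono ((memLp_two_iff_integrable_sq_norm hG).1
      (memLp_two_of_variance hG hsq)) hi fun z => ?_
    have h2 : ‖G z‖ ≤ ‖G z - e‖ + ‖e‖ := by simpa using norm_add_le (G z - e) e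
    have h3 := pow_le_pow_left₀ (norm_nonneg _) h2 2
    show ‖G z‖ ^ 2 ≤ 2 * ‖e‖ ^ 2 + 2 * ‖G z - e‖ ^ 2
    nlinarith [sq_nonneg (‖G z - e‖ - ‖e‖)]
  rw [integral_add (integrable_const _) (hsq.const_mul 2)] at h1
  have h4 := pow_le_pow_left₀ (norm_nonneg _) he 2
  simp only [integral_const_mul, integral_const, probReal_univ, smul_eq_mul, one_mul] at h1
  linarith

theorem integral_norm_average_sq_le {m : ℕ} {E : Type*} [NormedAddCommGroup E] [NormedSpace ℝ E]
    (hm : 1 ≤ m) {g : Fin m → Ω → E} {a : ℝ} (hg : ∀ i, MemLp (g i) 2 μ)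
    (h : ∀ i, ∫ ω, ‖g i ω‖ ^ 2 ∂μ ≤ a) : ∫ ω, ‖(m : ℝ)⁻¹ • ∑ i, g i ω‖ ^ 2 ∂μ ≤ a := by
  have hi : ∀ i, Integrable (fun ω => ‖g i ω‖ ^ 2) μ := fun i =>
    (memLp_two_iff_integrable_sq_norm (hg i).1).1 (hg i)
  refine (integral_mono_of_nonneg (.of_forall fun ω => by positivity)
    ((integrable_finsetSum Finset.univ fun i _ => hi i).const_mul (m : ℝ)⁻¹)
    (.of_forall fun ω => norm_average_sq_le fun i => g i ω)).trans ?_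
  rw [integral_const_mul, integral_finsetSum _ fun i _ => hi i]
  exact inv_mul_sum_const_le hm h

theorem memLp_average {m : ℕ} {E : Type*} [NormedAddCommGroup E] [NormedSpace ℝ E]
    {g : Fin m → Ω → E} (hg : ∀ i, MemLp (g i) 2 μ) :
    MemLp (fun ω => (m : ℝ)⁻¹ • ∑ i, g i ω) 2 μ :=
  (memLp_finsetSum Finset.univ fun i _ => hg i).const_smul (m : ℝ)⁻¹

theorem integral_average [IsProbabilityMeasure μ] {m : ℕ} {E : Type*} [NormedAddCommGroup E] [NormedSpace ℝ E]
    {g : Fin m → Ω → E} (hg : ∀ i, MemLp (g i) 2 μ) :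
    ∫ ω, (m : ℝ)⁻¹ • ∑ i, g i ω ∂μ = (m : ℝ)⁻¹ • ∑ i, ∫ ω, g i ω ∂μ := by
  rw [integral_smul, integral_finsetSum _ fun i _ => (hg i).integrable one_le_two]

/-! ### Sums with random client weights -/

section Weighted

variable {m : ℕ} {E : Type*} [NormedAddCommGroup E] [NormedSpace ℝ E]
  {c : Fin m → Ω → ℝ} {g : Fin m → Ω → E} {N : ℝ}

theorem norm_weighted_sum_sq_le {c : Fin m → ℝ} (hc : ∀ i, 0 ≤ c i) (hN : ∑ i, c i ≤ N)
    (g : Fin m → E) : ‖∑ i, c i • g i‖ ^ 2 ≤ N * ∑ i, c i * ‖g i‖ ^ 2 := by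
  have h1 : ‖∑ i, c i • g i‖ ≤ ∑ i, c i * ‖g i‖ := by
    refine (norm_sum_le _ _).trans (Finset.sum_le_sum fun i _ => ?_)
    rw [norm_smul, Real.norm_of_nonneg (hc i)]
  have h2 := Finset.sum_sq_le_sum_mul_sum_of_sq_le_mul Finset.univ (r := fun i => c i * ‖g i‖)
    (f := c) (g := fun i => c i * ‖g i‖ ^ 2) (fun i _ => hc i)
    (fun i _ => mul_nonneg (hc i) (by positivity)) (fun i _ => le_of_eq (by ring))
  calc ‖∑ i, c i • g i‖ ^ 2 ≤ (∑ i, c i * ‖g i‖) ^ 2 := pow_le_pow_left₀ (norm_nonneg _) h1 2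
    _ ≤ _ := h2
    _ ≤ _ := mul_le_mul_of_nonneg_right hN
      (Finset.sum_nonneg fun i _ => mul_nonneg (hc i) (by positivity))

theorem memLp_weighted_term (hcm : ∀ i, Measurable (c i)) (hc : ∀ i ω, 0 ≤ c i ω)
    (hN : ∀ ω, ∑ i, c i ω ≤ N) (hg : ∀ i, MemLp (g i) 2 μ) (i : Fin m) :
    MemLp (fun ω => c i ω • g i ω) 2 μ := by
  refine (hg i).of_le_mul (c := N) ((hcm i).aestronglyMeasurable.smul (hg i).1)
    (.of_forall fun ω => ?_)
  rw [norm_smul, Real.norm_of_nonneg (hc i ω)]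
  exact mul_le_mul_of_nonneg_right ((Finset.single_le_sum (fun j _ => hc j ω)
    (Finset.mem_univ i)).trans (hN ω)) (norm_nonneg _)

theorem integral_weighted_sum [IsProbabilityMeasure μ] [CompleteSpace E] [MeasurableSpace E] [BorelSpace E]
    (hcm : ∀ i, Measurable (c i)) (hc : ∀ i ω, 0 ≤ c i ω)
    (hN : ∀ ω, ∑ i, c i ω ≤ N) (hg : ∀ i, MemLp (g i) 2 μ)
    (hci : ∀ i, ∫ ω, c i ω ∂μ = (m : ℝ)⁻¹) (hind : ∀ i, IndepFun (c i) (g i) μ) :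
    ∫ ω, ∑ i, c i ω • g i ω ∂μ = (m : ℝ)⁻¹ • ∑ i, ∫ ω, g i ω ∂μ := by
  rw [integral_finsetSum _ fun i _ =>
    (memLp_weighted_term hcm hc hN hg i).integrable one_le_two, Finset.smul_sum]
  refine Finset.sum_congr rfl fun i _ => ?_
  rw [(hind i).integral_fun_smul_eq_smul_integral (hcm i).aestronglyMeasurable (hg i).1, hci]

/-- Weighted Cauchy–Schwarz costs one factor `N`, the bound on the total weight; the remaining
weights have mean 1/m and factor out by independence. The bound is therefore free of m. -/
theorem integral_norm_weighted_sum_sq_le [MeasurableSpace E] [BorelSpace E] (hm : 1 ≤ m)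
    (hcm : ∀ i, Measurable (c i)) (hc : ∀ i ω, 0 ≤ c i ω) (hN0 : 0 ≤ N)
    (hN : ∀ ω, ∑ i, c i ω ≤ N) (hg : ∀ i, MemLp (g i) 2 μ)
    (hci : ∀ i, ∫ ω, c i ω ∂μ = (m : ℝ)⁻¹) (hind : ∀ i, IndepFun (c i) (g i) μ) {a : ℝ}
    (ha : ∀ i, ∫ ω, ‖g i ω‖ ^ 2 ∂μ ≤ a) : ∫ ω, ‖∑ i, c i ω • g i ω‖ ^ 2 ∂μ ≤ N * a := by
  have hi : ∀ i, Integrable (fun ω => ‖g i ω‖ ^ 2) μ := fun i =>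
    (memLp_two_iff_integrable_sq_norm (hg i).1).1 (hg i)
  have hind' : ∀ i, IndepFun (c i) (fun ω => ‖g i ω‖ ^ 2) μ := fun i =>
    (hind i).comp measurable_id (measurable_norm.pow_const 2)
  have hbd : ∀ i, ∀ ω, c i ω ≤ N := fun i ω => (Finset.single_le_sum (fun j _ => hc j ω)
    (Finset.mem_univ i)).trans (hN ω)
  have hi' : ∀ i, Integrable (fun ω => c i ω * ‖g i ω‖ ^ 2) μ := fun i =>
    (hi i).bdd_mul (c := N) (hcm i).aestronglyMeasurable (.of_forall fun ω => by
      rw [Real.norm_of_nonneg (hc i ω)]; exact hbd i ω)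
  refine (integral_mono_of_nonneg (.of_forall fun ω => by positivity)
    ((integrable_finsetSum Finset.univ fun i _ => hi' i).const_mul N)
    (.of_forall fun ω => norm_weighted_sum_sq_le (fun i => hc i ω) (hN ω) fun i => g i ω)).trans ?_
  rw [integral_const_mul, integral_finsetSum _ fun i _ => hi' i]
  refine mul_le_mul_of_nonneg_left ?_ hN0
  have e : ∀ i, ∫ ω, c i ω * ‖g i ω‖ ^ 2 ∂μ = (m : ℝ)⁻¹ * ∫ ω, ‖g i ω‖ ^ 2 ∂μ := fun i => by
    rw [(hind' i).integral_fun_mul_eq_mul_integral (hcm i).aestronglyMeasurable (hi i).1, hci]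
  simp only [e, ← Finset.mul_sum]
  exact inv_mul_sum_const_le hm ha

end Weighted

/-! ### Moments of the hypergradient estimate and one-step expectations -/

section Hypergradient

variable {d₁ d₂ : ℕ} {A : Ω → Vec d₁ →L[ℝ] Vec d₂} {p : Ω → Vec d₂}

theorem norm_adjoint_apply_sq_le (A : Vec d₁ →L[ℝ] Vec d₂) (p : Vec d₂) :
    ‖ContinuousLinearMap.adjoint A p‖ ^ 2 ≤ ‖A‖ ^ 2 * ‖p‖ ^ 2 := by
  rw [← mul_pow]
  refine pow_le_pow_left₀ (norm_nonneg _) ((ContinuousLinearMap.le_opNorm _ _).trans ?_) 2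
  rw [LinearIsometryEquiv.norm_map]

theorem aestronglyMeasurable_adjoint_apply (hA : AEStronglyMeasurable A μ)
    (hp : AEStronglyMeasurable p μ) :
    AEStronglyMeasurable (fun ω => ContinuousLinearMap.adjoint (A ω) (p ω)) μ := by
  have h1 : AEStronglyMeasurable (fun ω => ContinuousLinearMap.adjoint (A ω)) μ :=
    (ContinuousLinearMap.adjoint (𝕜 := ℝ) (E := Vec d₁) (F := Vec d₂)).continuous
      |>.comp_aestronglyMeasurable hA
  exact (isBoundedBilinearMap_apply (𝕜 := ℝ) (E := Vec d₂) (F := Vec d₁)).continuous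
    |>.comp_aestronglyMeasurable (h1.prodMk hp)

/-- Independence of the Jacobian and gradient samples replaces fourth-moment assumptions. -/
theorem integrable_norm_sq_mul (hA : MemLp A 2 μ) (hp : MemLp p 2 μ) (hind : IndepFun A p μ) :
    Integrable (fun ω => ‖A ω‖ ^ 2 * ‖p ω‖ ^ 2) μ :=
  IndepFun.integrable_mul (hind.comp (measurable_norm.pow_const 2) (measurable_norm.pow_const 2))
    ((memLp_two_iff_integrable_sq_norm hA.1).1 hA) ((memLp_two_iff_integrable_sq_norm hp.1).1 hp)

theorem memLp_adjoint_apply (hA : MemLp A 2 μ) (hp : MemLp p 2 μ) (hind : IndepFun A p μ) :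
    MemLp (fun ω => ContinuousLinearMap.adjoint (A ω) (p ω)) 2 μ := by
  have hm := aestronglyMeasurable_adjoint_apply hA.1 hp.1
  refine (memLp_two_iff_integrable_sq_norm hm).2 ?_
  refine (integrable_norm_sq_mul hA hp hind).mono' (hm.norm.pow 2) (.of_forall fun ω => ?_)
  rw [Real.norm_of_nonneg (by positivity)]
  exact norm_adjoint_apply_sq_le _ _

theorem integral_norm_adjoint_apply_sq_le (hA : MemLp A 2 μ) (hp : MemLp p 2 μ)
    (hind : IndepFun A p μ) {a b : ℝ} (ha : ∫ ω, ‖A ω‖ ^ 2 ∂μ ≤ a) (hb : ∫ ω, ‖p ω‖ ^ 2 ∂μ ≤ b) :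
    ∫ ω, ‖ContinuousLinearMap.adjoint (A ω) (p ω)‖ ^ 2 ∂μ ≤ a * b := by
  refine (integral_mono_of_nonneg (.of_forall fun ω => by positivity)
    (integrable_norm_sq_mul hA hp hind)
    (.of_forall fun ω => norm_adjoint_apply_sq_le _ _)).trans ?_
  have h := IndepFun.integral_fun_mul_eq_mul_integral
    (hind.comp (measurable_norm.pow_const 2) (measurable_norm.pow_const 2))
    ((memLp_two_iff_integrable_sq_norm hA.1).1 hA).1
    ((memLp_two_iff_integrable_sq_norm hp.1).1 hp).1
  simp only [Function.comp_apply] at h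
  rw [h]
  have hA0 : 0 ≤ ∫ ω, ‖A ω‖ ^ 2 ∂μ := integral_nonneg fun ω => by positivity
  have hp0 : 0 ≤ ∫ ω, ‖p ω‖ ^ 2 ∂μ := integral_nonneg fun ω => by positivity
  exact mul_le_mul ha hb hp0 (hA0.trans ha)

theorem integral_inner_adjoint_apply [IsProbabilityMeasure μ] (hA : MemLp A 2 μ) (hp : MemLp p 2 μ) (hind : IndepFun A p μ)
    (v : Vec d₁) :
    ∫ ω, ⟪v, ContinuousLinearMap.adjoint (A ω) (p ω)⟫ ∂μ =
      ⟪v, ContinuousLinearMap.adjoint (∫ ω, A ω ∂μ) (∫ ω, p ω ∂μ)⟫ := by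
  have hAi := hA.integrable one_le_two
  simp only [ContinuousLinearMap.adjoint_inner_right]
  have hev : Measurable fun B : Vec d₁ →L[ℝ] Vec d₂ => B v :=
    (ContinuousLinearMap.apply ℝ (Vec d₂) v).continuous.measurable
  have h := IndepFun.integral_bilin (hind.comp hev measurable_id)
    (hAi.apply_continuousLinearMap v) (hp.integrable one_le_two) (innerSL ℝ)
  change ∫ ω, ⟪A ω v, p ω⟫ ∂μ = ⟪∫ ω, A ω v ∂μ, ∫ ω, p ω ∂μ⟫ at h
  rw [h, ContinuousLinearMap.integral_apply hAi]

/-- Expected change of the Lyapunov function in one round of FedOut. -/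
theorem lintegral_lyapunov_outStep_le [IsProbabilityMeasure μ] {F : Vec d₂ → ℝ} {ρ : Vec d₁ → Vec d₂} {a₀ a₁ b₀ b₁ : ℝ}
    (h : SmoothComposition F ρ a₀ a₁ b₀ b₁) {x : Vec d₁} {y : Vec d₂}
    (hA : MemLp A 2 μ) (hp : MemLp p 2 μ) (hind : IndepFun A p μ)
    (hAe : ∫ ω, A ω ∂μ = fderiv ℝ ρ x) (hpe : ∫ ω, p ω ∂μ = gradient F y) {a b M C₁ C₂ : ℝ}
    (ha : ∫ ω, ‖A ω‖ ^ 2 ∂μ ≤ a) (hb : ∫ ω, ‖p ω‖ ^ 2 ∂μ ≤ b) (hM : a * b ≤ M)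
    (hC₁ : (b₀ * a₁ + 2 * b₀) ^ 2 / 2 + 2 * b₀ * (b₀ * a₁) + b₁ * M ≤ C₁)
    (hC₂ : (b₀ ^ 2 * a₁ + b₁ * a₀ + b₀ ^ 2 + b₁) * M ≤ C₂)
    {α flow : ℝ} (hα0 : 0 ≤ α) (hα1 : α ≤ 1) (hflow : ∀ x', flow ≤ F (ρ x')) :
    ∫⁻ ω, ENNReal.ofReal (F (ρ (x - α • ContinuousLinearMap.adjoint (A ω) (p ω))) - flow +
        ‖y - ρ (x - α • ContinuousLinearMap.adjoint (A ω) (p ω))‖ ^ 2) ∂μ +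
      ENNReal.ofReal (α / 2 * ‖gradient (fun x => F (ρ x)) x‖ ^ 2) ≤
    ENNReal.ofReal (F (ρ x) - flow + C₂ * α ^ 2 + (1 + C₁ * α) * ‖y - ρ x‖ ^ 2) := by
  set H : Ω → Vec d₁ := fun ω => ContinuousLinearMap.adjoint (A ω) (p ω) with hH
  have hHm : MemLp H 2 μ := memLp_adjoint_apply hA hp hind
  set v := SmoothComposition.driftDirection F ρ x y
  set κ := b₀ ^ 2 * a₁ + b₁ * a₀ + b₀ ^ 2 + b₁ * (1 + ‖y - ρ x‖ ^ 2) with hκ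
  have hκ0 : 0 ≤ κ := by
    have := h.nonneg_a₀; have := h.nonneg_a₁; have := h.nonneg_b₀; have := h.nonneg_b₁
    positivity
  have i1 : Integrable (fun ω => ⟪v, H ω⟫) μ := (hHm.integrable one_le_two).const_inner v
  have i2 : Integrable (fun ω => ‖H ω‖ ^ 2) μ := (memLp_two_iff_integrable_sq_norm hHm.1).1 hHm
  have j1 : Integrable (fun ω => (F (ρ x) - flow + ‖y - ρ x‖ ^ 2) + α * ⟪v, H ω⟫) μ :=
    (integrable_const _).add (i1.const_mul α)
  have j2 : Integrable (fun ω => α ^ 2 * (κ * ‖H ω‖ ^ 2)) μ := (i2.const_mul κ).const_mul _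
  have j3 : Integrable (fun ω => (F (ρ x) - flow + ‖y - ρ x‖ ^ 2) + α * ⟪v, H ω⟫ +
      α ^ 2 * (κ * ‖H ω‖ ^ 2)) μ := j1.add j2
  have hle : ∀ ω, F (ρ (x - α • H ω)) - flow + ‖y - ρ (x - α • H ω)‖ ^ 2 ≤
      (F (ρ x) - flow + ‖y - ρ x‖ ^ 2) + α * ⟪v, H ω⟫ + α ^ 2 * (κ * ‖H ω‖ ^ 2) := fun ω => by
    have := h.lyapunov_sub_smul_le x y (H ω) α
    linarith
  have h1 : ∫⁻ ω, ENNReal.ofReal (F (ρ (x - α • H ω)) - flow + ‖y - ρ (x - α • H ω)‖ ^ 2) ∂μ ≤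
      ENNReal.ofReal (∫ ω, ((F (ρ x) - flow + ‖y - ρ x‖ ^ 2) + α * ⟪v, H ω⟫ +
        α ^ 2 * (κ * ‖H ω‖ ^ 2)) ∂μ) := by
    -- The majorant is nonnegative because it dominates the Lyapunov function, which `flow` keeps
    -- nonnegative.
    rw [ofReal_integral_eq_lintegral_ofReal j3 (.of_forall fun ω => le_trans
      (add_nonneg (sub_nonneg.2 (hflow _)) (by positivity)) (hle ω))]
    exact lintegral_mono fun ω => ENNReal.ofReal_le_ofReal (hle ω)
  refine (add_le_add h1 le_rfl).trans ?_
  rw [← ENNReal.ofReal_add (integral_nonneg fun ω => le_trans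
      (add_nonneg (sub_nonneg.2 (hflow _)) (by positivity)) (hle ω)) (by positivity)]
  refine ENNReal.ofReal_le_ofReal ?_
  rw [integral_add j1 j2, integral_add (integrable_const _) (i1.const_mul α), integral_const_mul,
    integral_const_mul, integral_const_mul, integral_inner_adjoint_apply hA hp hind v, hAe, hpe]
  simp only [integral_const, probReal_univ, smul_eq_mul, one_mul]
  have h2 := h.inner_driftDirection_le x y
  have h3 : ∫ ω, ‖H ω‖ ^ 2 ∂μ ≤ M := (integral_norm_adjoint_apply_sq_le hA hp hind ha hb).trans hM
  have h4 := mul_le_mul_of_nonneg_left h2 hα0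
  have h5 := mul_le_mul_of_nonneg_left (mul_le_mul_of_nonneg_left h3 hκ0) (sq_nonneg α)
  have hM0 : 0 ≤ M := (integral_nonneg fun ω => by positivity).trans h3
  have hD : 0 ≤ ‖y - ρ x‖ ^ 2 := by positivity
  -- By α ≤ 1, the error-dependent part of the quadratic term joins the order-α coefficient; this is
  -- the summand b₁ M of C₁.
  have h6 : α ^ 2 * (b₁ * M * ‖y - ρ x‖ ^ 2) ≤ α * (b₁ * M * ‖y - ρ x‖ ^ 2) :=
    mul_le_mul_of_nonneg_right (by nlinarith)
      (mul_nonneg (mul_nonneg h.nonneg_b₁ hM0) hD)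
  have h7 := mul_le_mul_of_nonneg_right hC₁ (mul_nonneg hα0 hD)
  have h8 := mul_le_mul_of_nonneg_right hC₂ (sq_nonneg α)
  rw [hκ] at h5 ⊢
  linarith

/-- Expected tracking error after one round of FedInn. -/
theorem lintegral_innStep_le [IsProbabilityMeasure μ] {E : Type*} [NormedAddCommGroup E] [InnerProductSpace ℝ E]
    [CompleteSpace E] {R : Ω → E} {e y : E} {s κ c₀ σ : ℝ} (hR : MemLp R 2 μ) (hRe : ∫ ω, R ω ∂μ = e)
    (hvar : ∫ ω, ‖R ω - e‖ ^ 2 ∂μ ≤ σ ^ 2) (hκ : 0 ≤ κ) (hc : 0 ≤ c₀) :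
    ∫⁻ ω, ENNReal.ofReal (c₀ + κ * ‖y - s • (y - R ω) - e‖ ^ 2) ∂μ ≤
      ENNReal.ofReal (c₀ + κ * ((1 - s) ^ 2 * ‖y - e‖ ^ 2 + s ^ 2 * σ ^ 2)) := by
  have hV : MemLp (fun ω => R ω - e) 2 μ := hR.sub (memLp_const e)
  have hVi := hV.integrable one_le_two
  have i2 : Integrable (fun ω => ‖R ω - e‖ ^ 2) μ := (memLp_two_iff_integrable_sq_norm hV.1).1 hV
  have i1 : Integrable (fun ω => ⟪(1 - s) • (y - e), R ω - e⟫) μ := hVi.const_inner _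
  have j1 : Integrable (fun ω => (c₀ + κ * ((1 - s) ^ 2 * ‖y - e‖ ^ 2)) +
      κ * (2 * s) * ⟪(1 - s) • (y - e), R ω - e⟫) μ := (integrable_const _).add (i1.const_mul _)
  have j2 : Integrable (fun ω => κ * s ^ 2 * ‖R ω - e‖ ^ 2) μ := i2.const_mul _
  -- The new error is (1 - s)(y - e) + s(R - e); the cross term has mean zero since e is the mean of
  -- R.
  have heq : ∀ ω, c₀ + κ * ‖y - s • (y - R ω) - e‖ ^ 2 =
      (c₀ + κ * ((1 - s) ^ 2 * ‖y - e‖ ^ 2)) + κ * (2 * s) * ⟪(1 - s) • (y - e), R ω - e⟫ +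
        κ * s ^ 2 * ‖R ω - e‖ ^ 2 := fun ω => by
    have e1 : y - s • (y - R ω) - e = (1 - s) • (y - e) + s • (R ω - e) := by module
    rw [e1, norm_add_sq_real, real_inner_smul_right, norm_smul s, mul_pow, norm_smul, mul_pow,
      Real.norm_eq_abs, Real.norm_eq_abs, sq_abs, sq_abs]
    ring
  rw [← ofReal_integral_eq_lintegral_ofReal]
  · refine ENNReal.ofReal_le_ofReal ?_
    simp only [heq]
    rw [integral_add j1 j2, integral_add (integrable_const _) (i1.const_mul _), integral_const_mul,
      integral_const_mul, integral_inner hVi, integral_sub (hR.integrable one_le_two)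
      (integrable_const _), hRe]
    simp only [integral_const, probReal_univ, smul_eq_mul, one_mul, one_smul, sub_self,
      inner_zero_right, mul_zero, add_zero]
    have := mul_le_mul_of_nonneg_left hvar (mul_nonneg hκ (sq_nonneg s))
    linarith
  · simp only [heq]
    exact j1.add j2
  · exact .of_forall fun ω => add_nonneg hc (by positivity)

end Hypergradient

end Moments

/-! ## Independence of the draws -/

section Sampling

/-- All places where FedNest draws something random. -/
abbrev Slot (m : ℕ) : Type := InnerSlot m ⊕ OuterSlot m ⊕ ℕ ⊕ (ℕ × ℕ)

/-- The half-round in which a draw is used: FedInn of round `k` is half-round `2 k`, FedIHGP and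
FedOut of round `k` are half-round `2 k + 1`. -/
def Slot.time {m : ℕ} : Slot m → ℕ
  | .inl (.innStart k _ _) => 2 * k
  | .inl (.innLocal k _ _ _) => 2 * k
  | .inl (.outStart k _) => 2 * k + 1
  | .inl (.ihgp k _ _) => 2 * k + 1
  | .inr (.inl (.outStart k _)) => 2 * k + 1
  | .inr (.inl (.outLocal k _ _)) => 2 * k + 1
  | .inr (.inl (.ihgp k _)) => 2 * k + 1
  | .inr (.inr (.inl k)) => 2 * k + 1
  | .inr (.inr (.inr kn)) => 2 * kn.1 + 1

variable {Ω Ξ Z : Type*} [MeasurableSpace Ξ] [MeasurableSpace Z] {m N : ℕ}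
  {W : Ω → Draws m Ξ Z}

/-- The σ-algebra generated by one draw. -/
abbrev drawSigma (W : Ω → Draws m Ξ Z) : Slot m → MeasurableSpace Ω :=
  Sum.elim (fun s : InnerSlot m => MeasurableSpace.comap (fun ω => (W ω).zeta s) inferInstance)
    (Sum.elim
      (fun s : OuterSlot m => MeasurableSpace.comap (fun ω => (W ω).xi s) inferInstance)
      (Sum.elim
        (fun k : ℕ => MeasurableSpace.comap (fun ω => (W ω).nPrime k) inferInstance)
        (fun kn : ℕ × ℕ => MeasurableSpace.comap (fun ω => (W ω).clients kn.1 kn.2) ⊤)))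

/-- The σ-algebra generated by the draws at a set of slots. -/
abbrev sigmaOf (W : Ω → Draws m Ξ Z) (S : Set (Slot m)) : MeasurableSpace Ω :=
  ⨆ s ∈ S, drawSigma W s

theorem drawSigma_le_sigmaOf {S : Set (Slot m)} {s : Slot m} (hs : s ∈ S) :
    drawSigma W s ≤ sigmaOf W S :=
  le_iSup₂_of_le s hs le_rfl

theorem sigmaOf_mono {S T : Set (Slot m)} (h : S ⊆ T) : sigmaOf W S ≤ sigmaOf W T :=
  biSup_mono fun _ hs => h hs

theorem measurable_zeta_sigmaOf {S : Set (Slot m)} {s : InnerSlot m} (hs : Sum.inl s ∈ S) :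
    Measurable[sigmaOf W S] fun ω => (W ω).zeta s :=
  Measurable.mono (comap_measurable _) (drawSigma_le_sigmaOf hs) le_rfl

theorem measurable_xi_sigmaOf {S : Set (Slot m)} {s : OuterSlot m}
    (hs : Sum.inr (Sum.inl s) ∈ S) : Measurable[sigmaOf W S] fun ω => (W ω).xi s :=
  Measurable.mono (comap_measurable _) (drawSigma_le_sigmaOf hs) le_rfl

theorem measurable_nPrime_sigmaOf {S : Set (Slot m)} {k : ℕ}
    (hs : Sum.inr (Sum.inr (Sum.inl k)) ∈ S) :
    Measurable[sigmaOf W S] fun ω => (W ω).nPrime k :=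
  Measurable.mono (comap_measurable _) (drawSigma_le_sigmaOf hs) le_rfl

theorem measurable_clients_sigmaOf {S : Set (Slot m)} {k n : ℕ}
    (hs : Sum.inr (Sum.inr (Sum.inr (k, n))) ∈ S) :
    Measurable[sigmaOf W S, ⊤] fun ω => (W ω).clients k n :=
  Measurable.mono (@comap_measurable _ _ ⊤ _) (drawSigma_le_sigmaOf (W := W) hs) le_rfl

theorem measurable_ihgpWeight_sigmaOf {S : Set (Slot m)} {k : ℕ}
    (h1 : Sum.inr (Sum.inr (Sum.inl k)) ∈ S) (h2 : Sum.inr (Sum.inr (Sum.inr (k, 0))) ∈ S)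
    (i : Fin m) :
    Measurable[sigmaOf W S] fun ω => ihgpWeight N ((W ω).nPrime k) ((W ω).clients k 0) i := by
  let _ : MeasurableSpace (Finset (Fin m)) := ⊤
  have : DiscreteMeasurableSpace (Finset (Fin m)) := ⟨fun _ => trivial⟩
  have hg : Measurable fun q : ℕ × Finset (Fin m) => ihgpWeight N q.1 q.2 i := .of_discrete
  exact hg.comp ((measurable_nPrime_sigmaOf h1).prodMk (measurable_clients_sigmaOf h2))

/-- The samples used by FedInn in round `k`. -/
def innNoise (W : Ω → Draws m Ξ Z) (k : ℕ) (ω : Ω) : Fin m → Z :=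
  fun i => (W ω).zeta (.innStart k 0 i)

/-- The samples and client weights used by FedIHGP and FedOut in round `k`. -/
def outNoise (W : Ω → Draws m Ξ Z) (N k : ℕ) (ω : Ω) :
    (Fin m → Z) × (Fin m → Ξ) × (Fin m → ℝ) :=
  (fun i => (W ω).zeta (.outStart k i), fun i => (W ω).xi (.ihgp k i),
    ihgpWeight N ((W ω).nPrime k) ((W ω).clients k 0))

theorem measurable_innNoise {S : Set (Slot m)} {k : ℕ}
    (hS : ∀ i, Sum.inl (.innStart k 0 i) ∈ S) : Measurable[sigmaOf W S] (innNoise W k) :=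
  @measurable_pi_lambda _ _ _ (sigmaOf W S) _ _ fun i => measurable_zeta_sigmaOf (hS i)

theorem measurable_outNoise_fst {S : Set (Slot m)} {k : ℕ}
    (h1 : ∀ i, Sum.inl (.outStart k i) ∈ S) :
    Measurable[sigmaOf W S] fun ω => (outNoise W N k ω).1 :=
  @measurable_pi_lambda _ _ _ (sigmaOf W S) _ _ fun i => measurable_zeta_sigmaOf (h1 i)

theorem measurable_outNoise_snd {S : Set (Slot m)} {k : ℕ}
    (h2 : ∀ i, Sum.inr (Sum.inl (.ihgp k i)) ∈ S) (h3 : Sum.inr (Sum.inr (Sum.inl k)) ∈ S)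
    (h4 : Sum.inr (Sum.inr (Sum.inr (k, 0))) ∈ S) :
    Measurable[sigmaOf W S] fun ω => (outNoise W N k ω).2 :=
  (@measurable_pi_lambda _ _ _ (sigmaOf W S) _ _ fun i => measurable_xi_sigmaOf (h2 i)).prodMk
    (@measurable_pi_lambda _ _ _ (sigmaOf W S) _ _ fun i => measurable_ihgpWeight_sigmaOf h3 h4 i)

theorem measurable_outNoise {S : Set (Slot m)} {k : ℕ}
    (h1 : ∀ i, Sum.inl (.outStart k i) ∈ S) (h2 : ∀ i, Sum.inr (Sum.inl (.ihgp k i)) ∈ S)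
    (h3 : Sum.inr (Sum.inr (Sum.inl k)) ∈ S) (h4 : Sum.inr (Sum.inr (Sum.inr (k, 0))) ∈ S) :
    Measurable[sigmaOf W S] (outNoise W N k) :=
  (measurable_outNoise_fst (N := N) h1).prodMk (measurable_outNoise_snd h2 h3 h4)

variable [mΩ : MeasurableSpace Ω] {μ : Measure Ω} {C : Fin m → Measure Ξ} {D : Fin m → Measure Z}

/-! ### Independence of disjoint groups of draws, and mean client weights -/

namespace IsSampling

theorem drawSigma_le (h : IsSampling μ C D N W) (s : Slot m) : drawSigma W s ≤ mΩ := by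
  rcases s with s | s | k | ⟨k, n⟩
  · exact (h.measurable_zeta s).comap_le
  · exact (h.measurable_xi s).comap_le
  · exact (h.measurable_nPrime k).comap_le
  · exact Measurable.comap_le (m₂ := ⊤)
      (@measurable_to_countable' _ _ ⊤ _ _ _ fun A => h.measurable_clients k n A)

theorem sigmaOf_le (h : IsSampling μ C D N W) (S : Set (Slot m)) : sigmaOf W S ≤ mΩ :=
  iSup₂_le fun s _ => h.drawSigma_le s

theorem indepFun (h : IsSampling μ C D N W) {S T : Set (Slot m)} (hST : Disjoint S T)
    {α β : Type*} [MeasurableSpace α] [MeasurableSpace β] {X : Ω → α} {Y : Ω → β}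
    (hX : Measurable[sigmaOf W S] X) (hY : Measurable[sigmaOf W T] Y) : IndepFun X Y μ :=
  indep_of_indep_of_le_left
    (indep_of_indep_of_le_right (indep_iSup_of_disjoint h.drawSigma_le h.indep hST)
      hY.comap_le) hX.comap_le

theorem measurePreserving_zeta (h : IsSampling μ C D N W) (s : InnerSlot m) :
    MeasurePreserving (fun ω => (W ω).zeta s) μ (D s.client) :=
  ⟨h.measurable_zeta s, h.law_zeta s⟩

theorem measurePreserving_xi (h : IsSampling μ C D N W) (s : OuterSlot m) :
    MeasurePreserving (fun ω => (W ω).xi s) μ (C s.client) :=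
  ⟨h.measurable_xi s, h.law_xi s⟩

theorem integral_clients [IsProbabilityMeasure μ] (h : IsSampling μ C D N W) (k n : ℕ)
    (g : Finset (Fin m) → ℝ) :
    ∫ ω, g ((W ω).clients k n) ∂μ = ∑ A, μ.real {ω | (W ω).clients k n = A} * g A := by
  have e : ∀ ω, g ((W ω).clients k n) =
      ∑ A, {ω | (W ω).clients k n = A}.indicator (fun _ => g A) ω := fun ω => by
    simp [Set.indicator_apply]
  simp only [e]
  rw [integral_finsetSum _ fun A _ =>
    (integrable_const (g A)).indicator (h.measurable_clients k n A)]
  refine Finset.sum_congr rfl fun A _ => ?_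
  rw [integral_indicator_const _ (h.measurable_clients k n A), smul_eq_mul]

/-- Transposing two clients preserves cardinality and hence the law of the set, so all clients have
the same mean weight; for a non-empty set the weights sum to 1. -/
theorem integral_uniformWeight [IsProbabilityMeasure μ] (h : IsSampling μ C D N W) (k n : ℕ)
    (i : Fin m) :
    ∫ ω, (if i ∈ (W ω).clients k n then (((W ω).clients k n).card : ℝ)⁻¹ else 0) ∂μ =
      (m : ℝ)⁻¹ := by
  set w : Fin m → ℝ := fun i =>
    ∫ ω, (if i ∈ (W ω).clients k n then (((W ω).clients k n).card : ℝ)⁻¹ else 0) ∂μ with hw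
  have hw' : ∀ i, w i = ∑ A, μ.real {ω | (W ω).clients k n = A} *
      (if i ∈ A then (A.card : ℝ)⁻¹ else 0) := fun i =>
    h.integral_clients k n fun A => if i ∈ A then (A.card : ℝ)⁻¹ else 0
  have hsymm : ∀ j, w j = w i := fun j => by
    rw [hw', hw', ← (Equiv.swap i j).finsetCongr.sum_comp]
    refine Finset.sum_congr rfl fun A _ => ?_
    simp only [Equiv.finsetCongr_apply, Finset.mem_map_equiv, Finset.card_map, Equiv.symm_swap,
      Equiv.swap_apply_right, h.law_clients k n _ A (Finset.card_map _)]
  have hsum : ∑ j, w j = 1 := by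
    rw [hw, ← integral_finsetSum]
    · have e : ∀ ω, ∑ j, (if j ∈ (W ω).clients k n then (((W ω).clients k n).card : ℝ)⁻¹ else 0) =
          1 := fun ω => by
        have : (((W ω).clients k n).card : ℝ) ≠ 0 := by
          exact_mod_cast (h.clients_nonempty k n ω).card_ne_zero
        simp [Finset.sum_ite_mem, this]
      simp [e]
    · intro j _
      have e : ∀ ω, (if j ∈ (W ω).clients k n then (((W ω).clients k n).card : ℝ)⁻¹ else 0) =
          ∑ A, {ω | (W ω).clients k n = A}.indicator
            (fun _ => if j ∈ A then (A.card : ℝ)⁻¹ else 0) ω := fun ω => by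
        simp [Set.indicator_apply]
      simp only [e]
      exact integrable_finsetSum _ fun A _ =>
        (integrable_const _).indicator (h.measurable_clients k n A)
  simp only [hsymm, Finset.sum_const, Finset.card_univ, Fintype.card_fin, nsmul_eq_mul] at hsum
  exact eq_inv_of_mul_eq_one_right hsum

/-- The factor N compensates the event N' = 0 of probability 1/N, which is independent of the client
set. -/
theorem integral_ihgpWeight [IsProbabilityMeasure μ] (h : IsSampling μ C D N W) (hN : 1 ≤ N)
    (k : ℕ) (i : Fin m) :
    ∫ ω, ihgpWeight N ((W ω).nPrime k) ((W ω).clients k 0) i ∂μ = (m : ℝ)⁻¹ := by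
  have hN' : (N : ℝ) ≠ 0 := by positivity
  set X : Ω → ℝ := fun ω => if (W ω).nPrime k = 0 then (N : ℝ) else 0
  set Y : Ω → ℝ := fun ω =>
    if i ∈ (W ω).clients k 0 then (((W ω).clients k 0).card : ℝ)⁻¹ else 0
  have e : ∀ ω, ihgpWeight N ((W ω).nPrime k) ((W ω).clients k 0) i = X ω * Y ω := fun ω => by
    simp only [ihgpWeight, X, Y]
    split_ifs <;> simp
  have hX : Measurable[sigmaOf W {Sum.inr (Sum.inr (Sum.inl k))}] X :=
    (measurable_of_countable fun n : ℕ => if n = 0 then (N : ℝ) else 0).comp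
      (measurable_nPrime_sigmaOf (Set.mem_singleton _))
  have hY : Measurable[sigmaOf W {Sum.inr (Sum.inr (Sum.inr (k, 0)))}] Y :=
    @Measurable.comp _ _ _ _ ⊤ _ _ _
      (measurable_from_top (f := fun A : Finset (Fin m) => if i ∈ A then (A.card : ℝ)⁻¹ else 0)) (measurable_clients_sigmaOf (Set.mem_singleton _))
  have hXY : IndepFun X Y μ := h.indepFun (by simp) hX hY
  simp only [e]
  rw [hXY.integral_fun_mul_eq_mul_integral
    (hX.mono (h.sigmaOf_le _) le_rfl).aestronglyMeasurable
    (hY.mono (h.sigmaOf_le _) le_rfl).aestronglyMeasurable, h.integral_uniformWeight]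
  have eX : ∀ ω, X ω = {ω | (W ω).nPrime k = 0}.indicator (fun _ => (N : ℝ)) ω := fun ω => by
    simp [X, Set.indicator_apply]
  have hms : MeasurableSet {ω | (W ω).nPrime k = 0} :=
    h.measurable_nPrime k (measurableSet_singleton 0)
  simp only [eX]
  rw [integral_indicator_const _ hms, h.law_nPrime k 0 hN]
  simp [hN']

end IsSampling

theorem ihgpWeight_nonneg (n : ℕ) (A : Finset (Fin m)) (i : Fin m) : 0 ≤ ihgpWeight N n A i := by
  unfold ihgpWeight
  split_ifs <;> positivity

theorem sum_ihgpWeight_le (n : ℕ) {A : Finset (Fin m)} (hA : A.Nonempty) :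
    ∑ i, ihgpWeight N n A i ≤ N := by
  have : (A.card : ℝ) ≠ 0 := by exact_mod_cast hA.card_ne_zero
  unfold ihgpWeight
  split_ifs
  · rw [Finset.sum_ite_mem, Finset.univ_inter, Finset.sum_const, nsmul_eq_mul]
    apply le_of_eq
    field_simp
  · simp

/-- Stands in for conditional expectation: the past `X` is frozen while the fresh noise `Y` is
integrated out. -/
theorem lintegral_indepFun [IsProbabilityMeasure μ] {α β : Type*} [MeasurableSpace α]
    [MeasurableSpace β] {X : Ω → α} {Y : Ω → β} (hX : Measurable X) (hY : Measurable Y)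
    (h : IndepFun X Y μ) {Φ : α × β → ENNReal} (hΦ : Measurable Φ) :
    ∫⁻ ω, Φ (X ω, Y ω) ∂μ = ∫⁻ ω, ∫⁻ ω', Φ (X ω, Y ω') ∂μ ∂μ := by
  have := Measure.isProbabilityMeasure_map (μ := μ) hY.aemeasurable
  rw [← lintegral_map hΦ (hX.prodMk hY),
    h.map_prod_eq_prod_map_map hX.aemeasurable hY.aemeasurable, lintegral_prod _ hΦ.aemeasurable,
    lintegral_map hΦ.lintegral_prod_right' hX]
  refine lintegral_congr fun ω => ?_
  exact lintegral_map (hΦ.comp measurable_prodMk_left) hY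

theorem integral_comp_measurePreserving {β E : Type*} [MeasurableSpace β] [NormedAddCommGroup E]
    [NormedSpace ℝ E] {Y : Ω → β} {ν : Measure β} (hY : MeasurePreserving Y μ ν) {g : β → E}
    (hg : AEStronglyMeasurable g ν) : ∫ ω, g (Y ω) ∂μ = ∫ y, g y ∂ν := by
  have := hY.map_eq
  subst this
  exact (integral_map hY.aemeasurable hg).symm

end Sampling

/-! ## One round of FedNest on a compositional problem -/

section Round

variable {Ω Ξ Z : Type*} [mΩ : MeasurableSpace Ω] [MeasurableSpace Ξ] [MeasurableSpace Z]
  {m d₁ d₂ N : ℕ} {μ : Measure Ω} [IsProbabilityMeasure μ]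
  {C : Fin m → Measure Ξ} {D : Fin m → Measure Z} {W : Ω → Draws m Ξ Z}
  {f : Fin m → Vec d₂ → Ξ → ℝ} {r : Fin m → Vec d₁ → Z → Vec d₂} {ℓf₀ ℓf₁ ℓr₀ ℓr₁ : ℝ≥0}
  {σf σr₀ σr₁ : ℝ}

/-- The sampled averaged Jacobian used by FedOut. -/
def sampledJacobian (r : Fin m → Vec d₁ → Z → Vec d₂) (x : Vec d₁) (z : Fin m → Z) :
    Vec d₁ →L[ℝ] Vec d₂ :=
  (m : ℝ)⁻¹ • ∑ i, fderiv ℝ (fun x' => r i x' (z i)) x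

/-- The weighted sampled outer gradient returned by FedIHGP. -/
def sampledGradient (f : Fin m → Vec d₂ → Ξ → ℝ) (y : Vec d₂) (ξ : Fin m → Ξ) (c : Fin m → ℝ) :
    Vec d₂ :=
  ∑ i, c i • gradient (fun y' => f i y' (ξ i)) y

namespace CompositionalAssumptions

theorem measurable_sampledJacobian
    (h : CompositionalAssumptions C D f r ℓf₀ ℓf₁ ℓr₀ ℓr₁ σf σr₀ σr₁) :
    Measurable fun q : Vec d₁ × (Fin m → Z) => sampledJacobian r q.1 q.2 := by
  have hs : Measurable fun q : Vec d₁ × (Fin m → Z) =>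
      ∑ i, fderiv ℝ (fun x' => r i x' (q.2 i)) q.1 :=
    Finset.measurable_fun_sum _ fun i _ => (h.measurable_deriv_r i).comp
      (measurable_fst.prodMk ((measurable_pi_apply i).comp measurable_snd))
  exact hs.const_smul (m : ℝ)⁻¹

theorem measurable_sampledGradient
    (h : CompositionalAssumptions C D f r ℓf₀ ℓf₁ ℓr₀ ℓr₁ σf σr₀ σr₁) :
    Measurable fun q : Vec d₂ × (Fin m → Ξ) × (Fin m → ℝ) => sampledGradient f q.1 q.2.1 q.2.2 := by
  refine Finset.measurable_fun_sum _ fun i _ => ?_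
  have hc : Measurable fun q : Vec d₂ × (Fin m → Ξ) × (Fin m → ℝ) => q.2.2 i :=
    (measurable_pi_apply i).comp (measurable_snd.comp measurable_snd)
  have hg : Measurable fun q : Vec d₂ × (Fin m → Ξ) × (Fin m → ℝ) =>
      gradient (fun y' => f i y' (q.2.1 i)) q.1 :=
    (h.measurable_grad_f i).comp (measurable_fst.prodMk
      ((measurable_pi_apply i).comp (measurable_fst.comp measurable_snd)))
  exact hc.smul hg

theorem measurable_innStep
    (h : CompositionalAssumptions C D f r ℓf₀ ℓf₁ ℓr₀ ℓr₁ σf σr₀ σr₁) (s : ℝ) :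
    Measurable fun q : (Vec d₁ × Vec d₂) × (Fin m → Z) => innStep r s q.1.1 q.1.2 q.2 := by
  have hy : Measurable fun q : (Vec d₁ × Vec d₂) × (Fin m → Z) => q.1.2 :=
    measurable_snd.comp measurable_fst
  have hs : Measurable fun q : (Vec d₁ × Vec d₂) × (Fin m → Z) => ∑ i, r i q.1.1 (q.2 i) :=
    Finset.measurable_fun_sum _ fun i _ => (h.measurable_r i).comp
      ((measurable_fst.comp measurable_fst).prodMk ((measurable_pi_apply i).comp measurable_snd))
  exact hy.sub ((hy.sub (hs.const_smul (m : ℝ)⁻¹)).const_smul s)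

theorem measurable_outStep
    (h : CompositionalAssumptions C D f r ℓf₀ ℓf₁ ℓr₀ ℓr₁ σf σr₀ σr₁) (α : ℝ) :
    Measurable fun q : (Vec d₁ × Vec d₂) × (Fin m → Z) × (Fin m → Ξ) × (Fin m → ℝ) =>
      outStep f r α q.1.1 q.1.2 q.2.1 q.2.2.1 q.2.2.2 := by
  have hx : Measurable fun q : (Vec d₁ × Vec d₂) × (Fin m → Z) × (Fin m → Ξ) × (Fin m → ℝ) =>
    q.1.1 := measurable_fst.comp measurable_fst
  have hA := h.measurable_sampledJacobian.comp (hx.prodMk (measurable_fst.comp measurable_snd))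
  have hp := h.measurable_sampledGradient.comp
    ((measurable_snd.comp measurable_fst).prodMk (measurable_snd.comp measurable_snd) :
      Measurable fun q : (Vec d₁ × Vec d₂) × (Fin m → Z) × (Fin m → Ξ) × (Fin m → ℝ) =>
        (q.1.2, q.2.2))
  have hadj : Measurable fun B : Vec d₁ →L[ℝ] Vec d₂ => ContinuousLinearMap.adjoint B :=
    (ContinuousLinearMap.adjoint (𝕜 := ℝ) (E := Vec d₁) (F := Vec d₂)).continuous.measurable
  have happ : Measurable fun q : (Vec d₂ →L[ℝ] Vec d₁) × Vec d₂ => q.1 q.2 :=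
    (isBoundedBilinearMap_apply (𝕜 := ℝ) (E := Vec d₂) (F := Vec d₁)).continuous.measurable
  exact hx.sub ((happ.comp ((hadj.comp hA).prodMk hp)).const_smul α)

theorem memLp_deriv_r (h : CompositionalAssumptions C D f r ℓf₀ ℓf₁ ℓr₀ ℓr₁ σf σr₀ σr₁)
    (i : Fin m) (x : Vec d₁) : MemLp (fun ζ => fderiv ℝ (fun x' => r i x' ζ) x) 2 (D i) :=
  have := h.prob_D i
  memLp_two_of_variance (h.integrable_deriv_r i x).1 (h.integrable_sq_deriv_r i x)

theorem memLp_grad_f (h : CompositionalAssumptions C D f r ℓf₀ ℓf₁ ℓr₀ ℓr₁ σf σr₀ σr₁)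
    (i : Fin m) (y : Vec d₂) : MemLp (fun ξ => gradient (fun y' => f i y' ξ) y) 2 (C i) :=
  have := h.prob_C i
  memLp_two_of_variance (h.integrable_grad_f i y).1 (h.integrable_sq_f i y)

theorem memLp_r (h : CompositionalAssumptions C D f r ℓf₀ ℓf₁ ℓr₀ ℓr₁ σf σr₀ σr₁)
    (i : Fin m) (x : Vec d₁) : MemLp (fun ζ => r i x ζ) 2 (D i) :=
  have := h.prob_D i
  memLp_two_of_variance (h.integrable_r i x).1 (h.integrable_sq_r i x)

/-- Expected change of the Lyapunov function in one round of FedIHGP and FedOut. -/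
theorem lintegral_outStep_le (h : CompositionalAssumptions C D f r ℓf₀ ℓf₁ ℓr₀ ℓr₁ σf σr₀ σr₁)
    (hm : 1 ≤ m) (hN : 1 ≤ N) (hW : IsSampling μ C D N W) (k : ℕ) (x : Vec d₁) (y : Vec d₂)
    {M C₁ C₂ : ℝ}
    (hM : (2 * (ℓr₀ : ℝ) ^ 2 + 2 * σr₁ ^ 2) * (N * (2 * (ℓf₀ : ℝ) ^ 2 + 2 * σf ^ 2)) ≤ M)
    (hC₁ : ((ℓr₀ : ℝ) * ℓf₁ + 2 * ℓr₀) ^ 2 / 2 + 2 * ℓr₀ * (ℓr₀ * ℓf₁) + ℓr₁ * M ≤ C₁)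
    (hC₂ : ((ℓr₀ : ℝ) ^ 2 * ℓf₁ + ℓr₁ * ℓf₀ + ℓr₀ ^ 2 + ℓr₁) * M ≤ C₂)
    {α flow : ℝ} (hα0 : 0 ≤ α) (hα1 : α ≤ 1)
    (hflow : ∀ x', flow ≤ meanOuter C f (meanInner D r x')) :
    ∫⁻ ω, (fun x' => ENNReal.ofReal (meanOuter C f (meanInner D r x') - flow +
        ‖y - meanInner D r x'‖ ^ 2)) (outStep f r α x y (outNoise W N k ω).1
          (outNoise W N k ω).2.1 (outNoise W N k ω).2.2) ∂μ +
      ENNReal.ofReal (α / 2 * ‖gradient (fun x => meanOuter C f (meanInner D r x)) x‖ ^ 2) ≤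
    ENNReal.ofReal (meanOuter C f (meanInner D r x) - flow + C₂ * α ^ 2 +
      (1 + C₁ * α) * ‖y - meanInner D r x‖ ^ 2) := by
  have hc0 : ∀ i ω, 0 ≤ ihgpWeight N ((W ω).nPrime k) ((W ω).clients k 0) i :=
    fun i ω => ihgpWeight_nonneg _ _ _
  have hcN : ∀ ω, ∑ i, ihgpWeight N ((W ω).nPrime k) ((W ω).clients k 0) i ≤ N :=
    fun ω => sum_ihgpWeight_le _ (hW.clients_nonempty k 0 ω)
  have hcm' : ∀ i, Measurable[sigmaOf W {Sum.inr (Sum.inr (Sum.inl k)),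
      Sum.inr (Sum.inr (Sum.inr (k, 0)))}] fun ω =>
      ihgpWeight N ((W ω).nPrime k) ((W ω).clients k 0) i := fun i =>
    measurable_ihgpWeight_sigmaOf (by simp) (by simp) i
  have hcm : ∀ i, Measurable fun ω => ihgpWeight N ((W ω).nPrime k) ((W ω).clients k 0) i :=
    fun i => (hcm' i).mono (hW.sigmaOf_le _) le_rfl
  have hci := fun i => hW.integral_ihgpWeight hN k i
  have hz : ∀ i, MeasurePreserving (fun ω => (W ω).zeta (.outStart k i)) μ (D i) :=
    fun i => hW.measurePreserving_zeta (.outStart k i)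
  have hξ : ∀ i, MeasurePreserving (fun ω => (W ω).xi (.ihgp k i)) μ (C i) :=
    fun i => hW.measurePreserving_xi (.ihgp k i)
  have hg : ∀ i, MemLp (fun ω => gradient (fun y' => f i y' ((W ω).xi (.ihgp k i))) y) 2 μ :=
    fun i => (h.memLp_grad_f i y).comp_measurePreserving (hξ i)
  have hB : ∀ i, MemLp (fun ω => fderiv ℝ (fun x' => r i x' ((W ω).zeta (.outStart k i))) x) 2 μ :=
    fun i => (h.memLp_deriv_r i x).comp_measurePreserving (hz i)
  have hgind : ∀ i, IndepFun (fun ω => ihgpWeight N ((W ω).nPrime k) ((W ω).clients k 0) i)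
      (fun ω => gradient (fun y' => f i y' ((W ω).xi (.ihgp k i))) y) μ := fun i => by
    refine hW.indepFun (T := {Sum.inr (Sum.inl (.ihgp k i))}) (by simp) (hcm' i) ?_
    exact ((h.measurable_grad_f i).comp measurable_prodMk_left).comp
      (measurable_xi_sigmaOf (Set.mem_singleton _))
  have hgi : ∀ i, ∫ ω, ‖gradient (fun y' => f i y' ((W ω).xi (.ihgp k i))) y‖ ^ 2 ∂μ ≤
      2 * (ℓf₀ : ℝ) ^ 2 + 2 * σf ^ 2 := fun i => by
    have := h.prob_C i
    have hm := (h.integrable_grad_f i y).1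
    rw [integral_comp_measurePreserving (hξ i)
      (g := fun ξ => ‖gradient (fun y' => f i y' ξ) y‖ ^ 2) (hm.norm.pow 2)]
    exact integral_norm_sq_le_of_variance hm (h.integrable_sq_f i y) (h.variance_f i y)
      (norm_gradient_le_of_lipschitz (h.lipschitz_f i) y)
  have hBi : ∀ i, ∫ ω, ‖fderiv ℝ (fun x' => r i x' ((W ω).zeta (.outStart k i))) x‖ ^ 2 ∂μ ≤
      2 * (ℓr₀ : ℝ) ^ 2 + 2 * σr₁ ^ 2 := fun i => by
    have := h.prob_D i
    have hm := (h.integrable_deriv_r i x).1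
    rw [integral_comp_measurePreserving (hz i)
      (g := fun ζ => ‖fderiv ℝ (fun x' => r i x' ζ) x‖ ^ 2) (hm.norm.pow 2)]
    exact integral_norm_sq_le_of_variance hm (h.integrable_sq_deriv_r i x)
      (h.variance_deriv_r i x) (norm_fderiv_le_of_lipschitz ℝ (h.lipschitz_r i))
  refine lintegral_lyapunov_outStep_le (h.smoothComposition hm)
    (A := fun ω => sampledJacobian r x fun i => (W ω).zeta (.outStart k i))
    (p := fun ω => sampledGradient f y (fun i => (W ω).xi (.ihgp k i))
      (ihgpWeight N ((W ω).nPrime k) ((W ω).clients k 0)))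
    (memLp_average hB)
    (memLp_finsetSum _ fun i _ => memLp_weighted_term hcm hc0 hcN hg i) ?_ ?_ ?_
    (integral_norm_average_sq_le hm hB hBi)
    (integral_norm_weighted_sum_sq_le hm hcm hc0 N.cast_nonneg hcN hg hci hgind hgi)
    hM hC₁ hC₂ hα0 hα1 hflow
  -- The Jacobian uses only inner samples; the gradient uses only outer samples, N' and the client
  -- set.
  · refine hW.indepFun (S := Set.range Sum.inl) (T := Set.range Sum.inr) ?_ ?_ ?_
    · rw [Set.disjoint_left]
      rintro _ ⟨a, rfl⟩ ⟨b, hb⟩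
      cases hb
    · exact (h.measurable_sampledJacobian.comp measurable_prodMk_left).comp
        (measurable_outNoise_fst (N := N) fun i => Set.mem_range_self _)
    · exact (h.measurable_sampledGradient.comp measurable_prodMk_left).comp
        (measurable_outNoise_snd (fun i => Set.mem_range_self _) (Set.mem_range_self _)
          (Set.mem_range_self _))
  · rw [(h.hasFDerivAt_meanInner x).fderiv]
    refine (integral_average hB).trans ?_
    congr 1
    refine Finset.sum_congr rfl fun i _ => ?_
    rw [← h.unbiased_deriv_r i x]
    exact integral_comp_measurePreserving (hz i) (h.integrable_deriv_r i x).1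
  · rw [(h.gradient_meanOuter y).gradient]
    refine (integral_weighted_sum hcm hc0 hcN hg hci hgind).trans ?_
    congr 1
    refine Finset.sum_congr rfl fun i _ => ?_
    rw [← h.unbiased_grad_f i y]
    exact integral_comp_measurePreserving (hξ i) (h.integrable_grad_f i y).1

/-- Expected tracking error after one round of FedInn. -/
theorem lintegral_innStep_le (h : CompositionalAssumptions C D f r ℓf₀ ℓf₁ ℓr₀ ℓr₁ σf σr₀ σr₁)
    (hm : 1 ≤ m) (hW : IsSampling μ C D N W) (k : ℕ) (x : Vec d₁) (y : Vec d₂)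
    {s κ c₀ : ℝ} (hκ : 0 ≤ κ) (hc : 0 ≤ c₀) :
    ∫⁻ ω, ENNReal.ofReal (c₀ + κ * ‖innStep r s x y (innNoise W k ω) -
        meanInner D r x‖ ^ 2) ∂μ ≤
      ENNReal.ofReal (c₀ + κ * ((1 - s) ^ 2 * ‖y - meanInner D r x‖ ^ 2 + s ^ 2 * σr₀ ^ 2)) := by
  have hz : ∀ i, MeasurePreserving (fun ω => (W ω).zeta (.innStart k 0 i)) μ (D i) :=
    fun i => hW.measurePreserving_zeta (.innStart k 0 i)
  have hr : ∀ i, MemLp (fun ω => r i x ((W ω).zeta (.innStart k 0 i))) 2 μ :=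
    fun i => (h.memLp_r i x).comp_measurePreserving (hz i)
  refine _root_.lintegral_innStep_le (memLp_average hr) ?_ ?_ hκ hc
  · refine (integral_average hr).trans ?_
    rw [meanInner]
    congr 1
    refine Finset.sum_congr rfl fun i _ => ?_
    exact integral_comp_measurePreserving (hz i) (h.integrable_r i x).1
  · have e : ∀ ω, (m : ℝ)⁻¹ • ∑ i, r i x ((W ω).zeta (.innStart k 0 i)) - meanInner D r x =
        (m : ℝ)⁻¹ • ∑ i, (r i x ((W ω).zeta (.innStart k 0 i)) - ∫ ζ, r i x ζ ∂(D i)) := fun ω => by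
      rw [Finset.sum_sub_distrib, smul_sub, meanInner]
    refine (integral_congr_ae (.of_forall fun ω => congrArg (fun v => ‖v‖ ^ 2) (e ω))).trans_le ?_
    refine integral_norm_average_sq_le hm (fun i => (hr i).sub (memLp_const _)) fun i => ?_
    rw [integral_comp_measurePreserving (hz i)
      (g := fun z => ‖r i x z - ∫ ζ, r i x ζ ∂(D i)‖ ^ 2) (h.integrable_sq_r i x).1]
    exact h.variance_r i x

end CompositionalAssumptions

end Round

/-! ## The run of FedNest -/

section Run

variable {Ω Ξ Z : Type*} {m d₁ d₂ N : ℕ} {W : Ω → Draws m Ξ Z}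
  {f : Fin m → Vec d₂ → Ξ → ℝ} {r : Fin m → Vec d₁ → Z → Vec d₂}

/-- The iterates `(x^k, y^k)` of FedNest with `T = 1` on a compositional problem, where `s` is the
effective step size of FedInn. -/
def run (f : Fin m → Vec d₂ → Ξ → ℝ) (r : Fin m → Vec d₁ → Z → Vec d₂) (N : ℕ) (s α : ℝ)
    (x₀ : Vec d₁) (y₀ : Vec d₂) (W : Ω → Draws m Ξ Z) : ℕ → Ω → Vec d₁ × Vec d₂
  | 0, _ => (x₀, y₀)
  | k + 1, ω =>
    let S := run f r N s α x₀ y₀ W k ω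
    let y' := innStep r s S.1 S.2 (innNoise W k ω)
    (outStep f r α S.1 y' (outNoise W N k ω).1 (outNoise W N k ω).2.1 (outNoise W N k ω).2.2, y')

/-- The pairs `(x^k, y^{k+1})`. -/
def halfRun (f : Fin m → Vec d₂ → Ξ → ℝ) (r : Fin m → Vec d₁ → Z → Vec d₂) (N : ℕ) (s α : ℝ)
    (x₀ : Vec d₁) (y₀ : Vec d₂) (W : Ω → Draws m Ξ Z) (k : ℕ) (ω : Ω) : Vec d₁ × Vec d₂ :=
  ((run f r N s α x₀ y₀ W k ω).1, innStep r s (run f r N s α x₀ y₀ W k ω).1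
    (run f r N s α x₀ y₀ W k ω).2 (innNoise W k ω))

theorem fedNest_eq_run (hm : 1 ≤ m) (τ : Fin m → ℕ) (hτ : ∀ i, 1 ≤ τ i) (α : ℝ) (b : Fin m → ℝ)
    (x₀ : Vec d₁) (y₀ : Vec d₂) (k : ℕ) (ω : Ω) :
    fedNest (compositional f r) 1 N 1 τ (fun _ i => α / τ i) (fun _ => b) x₀ y₀ (W ω) k =
      run f r N (effectiveStep τ b) α x₀ y₀ W k ω := by
  induction k with
  | zero => rfl
  | succ k ih =>
    rw [fedNest_compositional_succ hm f r N τ hτ, ih]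
    rfl

variable [MeasurableSpace Ξ] [MeasurableSpace Z] {C : Fin m → Measure Ξ} {D : Fin m → Measure Z}
  {ℓf₀ ℓf₁ ℓr₀ ℓr₁ : ℝ≥0} {σf σr₀ σr₁ s α : ℝ} {x₀ : Vec d₁} {y₀ : Vec d₂}

/-! ### Adaptedness of the iterates and Lyapunov descent -/

namespace CompositionalAssumptions

theorem measurable_halfRun_of_run
    (h : CompositionalAssumptions C D f r ℓf₀ ℓf₁ ℓr₀ ℓr₁ σf σr₀ σr₁) {k : ℕ}
    (hk : Measurable[sigmaOf W {t | t.time < 2 * k}] (run f r N s α x₀ y₀ W k)) :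
    Measurable[sigmaOf W {t | t.time < 2 * k + 1}] (halfRun f r N s α x₀ y₀ W k) := by
  have h1 : Measurable[sigmaOf W {t | t.time < 2 * k + 1}] (run f r N s α x₀ y₀ W k) :=
    hk.mono (sigmaOf_mono fun t ht => Nat.lt_succ_of_lt ht) le_rfl
  have h2 : Measurable[sigmaOf W {t | t.time < 2 * k + 1}] (innNoise W k) :=
    measurable_innNoise fun i => by simp [Slot.time]
  exact (measurable_fst.comp h1).prodMk ((h.measurable_innStep s).comp (h1.prodMk h2))

/-- The state at round k is a function of draws from earlier half-rounds only; this is what makes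
the noise of round k independent of it. -/
theorem measurable_run (h : CompositionalAssumptions C D f r ℓf₀ ℓf₁ ℓr₀ ℓr₁ σf σr₀ σr₁) (k : ℕ) :
    Measurable[sigmaOf W {t | t.time < 2 * k}] (run f r N s α x₀ y₀ W k) := by
  induction k with
  | zero => exact @measurable_const _ _ _ (sigmaOf W _) (x₀, y₀)
  | succ k ih =>
    have h1 : Measurable[sigmaOf W {t | t.time < 2 * (k + 1)}] (halfRun f r N s α x₀ y₀ W k) :=
      (h.measurable_halfRun_of_run ih).mono
        (sigmaOf_mono fun t (ht : t.time < 2 * k + 1) => show t.time < 2 * (k + 1) by omega) le_rfl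
    have h2 : Measurable[sigmaOf W {t | t.time < 2 * (k + 1)}] (outNoise W N k) :=
      measurable_outNoise (fun i => show 2 * k + 1 < 2 * (k + 1) by omega)
        (fun i => show 2 * k + 1 < 2 * (k + 1) by omega)
        (show 2 * k + 1 < 2 * (k + 1) by omega) (show 2 * k + 1 < 2 * (k + 1) by omega)
    exact ((h.measurable_outStep α).comp (h1.prodMk h2)).prodMk (measurable_snd.comp h1)

theorem measurable_halfRun (h : CompositionalAssumptions C D f r ℓf₀ ℓf₁ ℓr₀ ℓr₁ σf σr₀ σr₁)
    (k : ℕ) : Measurable[sigmaOf W {t | t.time < 2 * k + 1}] (halfRun f r N s α x₀ y₀ W k) :=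
  h.measurable_halfRun_of_run (h.measurable_run k)

variable [mΩ : MeasurableSpace Ω] {μ : Measure Ω}

theorem indepFun_run_innNoise (h : CompositionalAssumptions C D f r ℓf₀ ℓf₁ ℓr₀ ℓr₁ σf σr₀ σr₁)
    (hW : IsSampling μ C D N W) (k : ℕ) :
    IndepFun (run f r N s α x₀ y₀ W k) (innNoise W k) μ := by
  refine hW.indepFun (T := {t | t.time = 2 * k}) ?_ (h.measurable_run k)
    (measurable_innNoise fun i => rfl)
  rw [Set.disjoint_left]
  intro t (h1 : t.time < 2 * k) (h2 : t.time = 2 * k)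
  omega

theorem indepFun_halfRun_outNoise
    (h : CompositionalAssumptions C D f r ℓf₀ ℓf₁ ℓr₀ ℓr₁ σf σr₀ σr₁)
    (hW : IsSampling μ C D N W) (k : ℕ) :
    IndepFun (halfRun f r N s α x₀ y₀ W k) (outNoise W N k) μ := by
  refine hW.indepFun (T := {t | t.time = 2 * k + 1}) ?_ (h.measurable_halfRun k)
    (measurable_outNoise (fun i => rfl) (fun i => rfl) rfl rfl)
  rw [Set.disjoint_left]
  intro t (h1 : t.time < 2 * k + 1) (h2 : t.time = 2 * k + 1)
  omega

/-- Both parameters are free because between the half-rounds the weight is 1 + C₁ α and `flow` is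
shifted by C₂ α². -/
theorem measurable_lyapunov (h : CompositionalAssumptions C D f r ℓf₀ ℓf₁ ℓr₀ ℓr₁ σf σr₀ σr₁)
    (hm : 1 ≤ m) (flow κ : ℝ) :
    Measurable fun q : Vec d₁ × Vec d₂ => meanOuter C f (meanInner D r q.1) - flow +
      κ * ‖q.2 - meanInner D r q.1‖ ^ 2 := by
  have hF := (h.smoothComposition hm).differentiable_outer.continuous
  have hρ := (h.smoothComposition hm).differentiable_inner.continuous
  exact Continuous.measurable (by fun_prop)

/-- One-round decrease of the expected Lyapunov function along FedNest. -/
theorem lintegral_run_succ_le [IsProbabilityMeasure μ]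
    (h : CompositionalAssumptions C D f r ℓf₀ ℓf₁ ℓr₀ ℓr₁ σf σr₀ σr₁)
    (hm : 1 ≤ m) (hN : 1 ≤ N) (hW : IsSampling μ C D N W) (k : ℕ) {M C₁ C₂ β flow : ℝ}
    (hM : (2 * (ℓr₀ : ℝ) ^ 2 + 2 * σr₁ ^ 2) * (N * (2 * (ℓf₀ : ℝ) ^ 2 + 2 * σf ^ 2)) ≤ M)
    (hC₁ : ((ℓr₀ : ℝ) * ℓf₁ + 2 * ℓr₀) ^ 2 / 2 + 2 * ℓr₀ * (ℓr₀ * ℓf₁) + ℓr₁ * M ≤ C₁)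
    (hC₂ : ((ℓr₀ : ℝ) ^ 2 * ℓf₁ + ℓr₁ * ℓf₀ + ℓr₀ ^ 2 + ℓr₁) * M ≤ C₂)
    (hC₁0 : 0 ≤ C₁) (hC₂0 : 0 ≤ C₂) (hα0 : 0 ≤ α) (hα1 : α ≤ 1) (hβ1 : β ≤ 1)
    (hβ : 2 * C₁ * α ≤ β) (hs : β / 2 ≤ s ∧ s ≤ β)
    (hflow : ∀ x', flow ≤ meanOuter C f (meanInner D r x')) :
    ∫⁻ ω, ENNReal.ofReal (meanOuter C f (meanInner D r (run f r N s α x₀ y₀ W (k + 1) ω).1) - flow +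
        1 * ‖(run f r N s α x₀ y₀ W (k + 1) ω).2 -
          meanInner D r (run f r N s α x₀ y₀ W (k + 1) ω).1‖ ^ 2) ∂μ +
      ∫⁻ ω, ENNReal.ofReal (α / 2 * ‖gradient (fun x => meanOuter C f (meanInner D r x))
        (run f r N s α x₀ y₀ W k ω).1‖ ^ 2) ∂μ ≤
    ∫⁻ ω, ENNReal.ofReal (meanOuter C f (meanInner D r (run f r N s α x₀ y₀ W k ω).1) - flow +
        1 * ‖(run f r N s α x₀ y₀ W k ω).2 -
          meanInner D r (run f r N s α x₀ y₀ W k ω).1‖ ^ 2) ∂μ +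
      ENNReal.ofReal (C₂ * α ^ 2 + (1 + C₁) * β ^ 2 * σr₀ ^ 2) := by
  have hX : Measurable (run f r N s α x₀ y₀ W k) :=
    (h.measurable_run k).mono (hW.sigmaOf_le _) le_rfl
  have hH : Measurable (halfRun f r N s α x₀ y₀ W k) :=
    (h.measurable_halfRun k).mono (hW.sigmaOf_le _) le_rfl
  have hI : Measurable (innNoise W k) :=
    (measurable_innNoise (S := Set.univ) fun i => trivial).mono (hW.sigmaOf_le _) le_rfl
  have hO : Measurable (outNoise W N k) :=
    (measurable_outNoise (S := Set.univ) (fun i => trivial) (fun i => trivial) trivial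
      trivial).mono (hW.sigmaOf_le _) le_rfl
  have hG : Measurable fun x => ENNReal.ofReal (α / 2 *
      ‖gradient (fun x => meanOuter C f (meanInner D r x)) x‖ ^ 2) := by
    have := (h.smoothComposition hm).continuous_gradient_comp
    exact (Continuous.measurable (by fun_prop)).ennreal_ofReal
  have e1 := lintegral_indepFun hH hO (h.indepFun_halfRun_outNoise hW k)
    (Φ := fun q => ENNReal.ofReal (meanOuter C f (meanInner D r
      (outStep f r α q.1.1 q.1.2 q.2.1 q.2.2.1 q.2.2.2)) - flow +
      1 * ‖q.1.2 - meanInner D r (outStep f r α q.1.1 q.1.2 q.2.1 q.2.2.1 q.2.2.2)‖ ^ 2))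
    ((h.measurable_lyapunov hm flow 1).comp ((h.measurable_outStep α).prodMk
      (measurable_snd.comp measurable_fst))).ennreal_ofReal
  have e2 := lintegral_indepFun hX hI (h.indepFun_run_innNoise hW k)
    (Φ := fun q => ENNReal.ofReal (meanOuter C f (meanInner D r q.1.1) - (flow - C₂ * α ^ 2) +
      (1 + C₁ * α) * ‖innStep r s q.1.1 q.1.2 q.2 - meanInner D r q.1.1‖ ^ 2))
    ((h.measurable_lyapunov hm (flow - C₂ * α ^ 2) (1 + C₁ * α)).comp
      ((measurable_fst.comp measurable_fst).prodMk (h.measurable_innStep s))).ennreal_ofReal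
  have l1 : ∫⁻ ω, ENNReal.ofReal
        (meanOuter C f (meanInner D r (run f r N s α x₀ y₀ W (k + 1) ω).1) - flow +
        1 * ‖(run f r N s α x₀ y₀ W (k + 1) ω).2 -
          meanInner D r (run f r N s α x₀ y₀ W (k + 1) ω).1‖ ^ 2) ∂μ +
      ∫⁻ ω, ENNReal.ofReal (α / 2 * ‖gradient (fun x => meanOuter C f (meanInner D r x))
        (run f r N s α x₀ y₀ W k ω).1‖ ^ 2) ∂μ ≤
      ∫⁻ ω, ENNReal.ofReal (meanOuter C f (meanInner D r (run f r N s α x₀ y₀ W k ω).1) -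
        (flow - C₂ * α ^ 2) + (1 + C₁ * α) * ‖innStep r s (run f r N s α x₀ y₀ W k ω).1
          (run f r N s α x₀ y₀ W k ω).2 (innNoise W k ω) -
            meanInner D r (run f r N s α x₀ y₀ W k ω).1‖ ^ 2) ∂μ := by
    refine (add_le_add e1.le le_rfl).trans ?_
    have hG' : Measurable fun ω => ENNReal.ofReal (α / 2 *
        ‖gradient (fun x => meanOuter C f (meanInner D r x))
          (run f r N s α x₀ y₀ W k ω).1‖ ^ 2) := hG.comp (measurable_fst.comp hX)
    rw [← lintegral_add_right _ hG']
    refine lintegral_mono fun ω => ?_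
    have := h.lintegral_outStep_le hm hN hW k (halfRun f r N s α x₀ y₀ W k ω).1
      (halfRun f r N s α x₀ y₀ W k ω).2 hM hC₁ hC₂ hα0 hα1 hflow
    simp only [one_mul, sub_sub_eq_add_sub]
    rw [add_sub_right_comm]
    exact this
  refine l1.trans (e2.le.trans ?_)
  rw [← one_mul (ENNReal.ofReal (C₂ * α ^ 2 + _)), ← measure_univ (μ := μ), mul_comm (μ Set.univ),
    ← lintegral_const, ← lintegral_add_right _ measurable_const]
  refine lintegral_mono fun ω => ?_
  generalize run f r N s α x₀ y₀ W k ω = q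
  have hκ : 0 ≤ 1 + C₁ * α := by positivity
  have hc : 0 ≤ meanOuter C f (meanInner D r q.1) - (flow - C₂ * α ^ 2) := by
    have := hflow q.1
    have : 0 ≤ C₂ * α ^ 2 := by positivity
    linarith
  refine (h.lintegral_innStep_le hm hW k q.1 q.2 hκ hc).trans ?_
  rw [← ENNReal.ofReal_add (add_nonneg (sub_nonneg.2 (hflow _)) (by positivity)) (by positivity)]
  refine ENNReal.ofReal_le_ofReal ?_
  have hβ0 : 0 ≤ β := le_trans (by positivity) hβ
  have hs0 : 0 ≤ s := by linarith
  -- Here 0 ≤ s ≤ 1 gives (1 - s)² ≤ 1 - s, and s ≥ β/2 ≥ C₁ α; then (1 + C₁ α)(1 - C₁ α) ≤ 1.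
  have k1 : (1 + C₁ * α) * (1 - s) ^ 2 ≤ 1 := by
    have a1 : (1 - s) ^ 2 ≤ 1 - C₁ * α := by nlinarith
    nlinarith [mul_le_mul_of_nonneg_left a1 hκ, sq_nonneg (C₁ * α)]
  have k2 : (1 + C₁ * α) * s ^ 2 ≤ (1 + C₁) * β ^ 2 :=
    mul_le_mul (by nlinarith) (pow_le_pow_left₀ hs0 hs.2 2) (sq_nonneg _) (by positivity)
  have k3 := mul_le_mul_of_nonneg_right k1 (sq_nonneg ‖q.2 - meanInner D r q.1‖)
  have k4 := mul_le_mul_of_nonneg_right k2 (sq_nonneg σr₀)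
  linarith

/-- Telescoped form of the one-round decrease. -/
theorem sum_lintegral_run_le [IsProbabilityMeasure μ]
    (h : CompositionalAssumptions C D f r ℓf₀ ℓf₁ ℓr₀ ℓr₁ σf σr₀ σr₁)
    (hm : 1 ≤ m) (hN : 1 ≤ N) (hW : IsSampling μ C D N W) (n : ℕ) {M C₁ C₂ β flow : ℝ}
    (hM : (2 * (ℓr₀ : ℝ) ^ 2 + 2 * σr₁ ^ 2) * (N * (2 * (ℓf₀ : ℝ) ^ 2 + 2 * σf ^ 2)) ≤ M)
    (hC₁ : ((ℓr₀ : ℝ) * ℓf₁ + 2 * ℓr₀) ^ 2 / 2 + 2 * ℓr₀ * (ℓr₀ * ℓf₁) + ℓr₁ * M ≤ C₁)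
    (hC₂ : ((ℓr₀ : ℝ) ^ 2 * ℓf₁ + ℓr₁ * ℓf₀ + ℓr₀ ^ 2 + ℓr₁) * M ≤ C₂)
    (hC₁0 : 0 ≤ C₁) (hC₂0 : 0 ≤ C₂) (hα0 : 0 ≤ α) (hα1 : α ≤ 1) (hβ1 : β ≤ 1)
    (hβ : 2 * C₁ * α ≤ β) (hs : β / 2 ≤ s ∧ s ≤ β)
    (hflow : ∀ x', flow ≤ meanOuter C f (meanInner D r x')) :
    ∑ k ∈ Finset.range n, ∫⁻ ω, ENNReal.ofReal (α / 2 *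
        ‖gradient (fun x => meanOuter C f (meanInner D r x))
          (run f r N s α x₀ y₀ W k ω).1‖ ^ 2) ∂μ ≤
      ENNReal.ofReal (meanOuter C f (meanInner D r x₀) - flow + ‖y₀ - meanInner D r x₀‖ ^ 2 +
        n * (C₂ * α ^ 2 + (1 + C₁) * β ^ 2 * σr₀ ^ 2)) := by
  have hE : 0 ≤ C₂ * α ^ 2 + (1 + C₁) * β ^ 2 * σr₀ ^ 2 := by positivity
  have hΨ : 0 ≤ meanOuter C f (meanInner D r x₀) - flow + ‖y₀ - meanInner D r x₀‖ ^ 2 :=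
    add_nonneg (sub_nonneg.2 (hflow _)) (by positivity)
  -- The induction needs the final Lyapunov value on the left.
  refine le_trans (le_add_left (le_refl _) (b := ∫⁻ ω, ENNReal.ofReal (meanOuter C f
    (meanInner D r (run f r N s α x₀ y₀ W n ω).1) - flow + 1 * ‖(run f r N s α x₀ y₀ W n ω).2 -
      meanInner D r (run f r N s α x₀ y₀ W n ω).1‖ ^ 2) ∂μ)) ?_
  induction n with
  | zero => simp [run]
  | succ n ih =>
    have h1 := h.lintegral_run_succ_le (x₀ := x₀) (y₀ := y₀) hm hN hW n hM hC₁ hC₂ hC₁0 hC₂0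
      hα0 hα1 hβ1 hβ hs hflow
    rw [Finset.sum_range_succ, add_comm (∑ k ∈ _, _), ← add_assoc]
    refine (add_le_add h1 le_rfl).trans ?_
    rw [add_right_comm]
    refine (add_le_add ih le_rfl).trans ?_
    rw [← ENNReal.ofReal_add (by positivity) hE]
    refine ENNReal.ofReal_le_ofReal (le_of_eq ?_)
    push_cast
    ring

end CompositionalAssumptions

end Run

/-! ## The convergence rate -/

/-- Dividing by α/2 leaves B/α and K E α up to constants. The first is O(√K) since 1/α is the
maximum of 1/a and √K/α', the second since α √K ≤ α'; K + 1 ≤ 2K produces the 4. -/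
theorem rate_of_min_step {a α' α S B E : ℝ} {K : ℕ} (ha : 0 < a) (hα' : 0 < α')
    (hK : 1 ≤ K) (hα : α = min a (α' / √(K : ℝ))) (hB : 0 ≤ B) (hE : 0 ≤ E)
    (hS : α / 2 * S ≤ B + (K + 1) * (E * α ^ 2)) :
    1 / (K : ℝ) * S ≤ (2 * B * (1 / a + 1 / α') + 4 * E * α') / √(K : ℝ) := by
  have hK1 : (1 : ℝ) ≤ K := by exact_mod_cast hK
  have hq : 0 < √(K : ℝ) := Real.sqrt_pos.2 (by linarith)
  have hqq : √(K : ℝ) * √(K : ℝ) = K := Real.mul_self_sqrt (by linarith)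
  have hq1 : 1 ≤ √(K : ℝ) := Real.one_le_sqrt.2 hK1
  have hα0 : 0 < α := hα ▸ lt_min ha (by positivity)
  have h1 : α * √(K : ℝ) ≤ α' := by
    rw [← le_div_iff₀ hq]; exact hα ▸ min_le_right _ _
  have h2 : 1 / α ≤ (1 / a + 1 / α') * √(K : ℝ) := by
    rw [div_le_iff₀ hα0]
    rcases min_choice a (α' / √(K : ℝ)) with h | h
    · have e : α = a := hα.trans h
      have e1 : (1 / a + 1 / α') * √(K : ℝ) * α = √(K : ℝ) + 1 / α' * √(K : ℝ) * α := by
        rw [e]; field_simp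
      rw [e1]
      have : 0 ≤ 1 / α' * √(K : ℝ) * α := by positivity
      linarith
    · have e : α = α' / √(K : ℝ) := hα.trans h
      have e1 : (1 / a + 1 / α') * √(K : ℝ) * α = 1 / a * √(K : ℝ) * α + 1 := by
        rw [e]; field_simp
      rw [e1]
      have : 0 ≤ 1 / a * √(K : ℝ) * α := by positivity
      linarith
  have h3 : S ≤ 2 * B * (1 / α) + 2 * (K + 1) * (E * α) := by
    have : S = (α / 2 * S) * (2 * (1 / α)) := by field_simp
    rw [this]
    refine (mul_le_mul_of_nonneg_right hS (by positivity)).trans (le_of_eq ?_)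
    field_simp
  have h4 : 2 * (K + 1) * (E * α) ≤ 4 * E * α' * √(K : ℝ) := by
    calc 2 * (K + 1) * (E * α) ≤ 2 * (K + K) * (E * α) := by gcongr
      _ = 4 * E * (α * √(K : ℝ)) * √(K : ℝ) := by
        linear_combination -(4 * E * α) * hqq
      _ ≤ 4 * E * α' * √(K : ℝ) := by gcongr
  have h5 : 2 * B * (1 / α) ≤ 2 * B * ((1 / a + 1 / α') * √(K : ℝ)) := by gcongr
  rw [le_div_iff₀ hq, one_div, inv_mul_eq_div, div_mul_eq_mul_div, div_le_iff₀ (by linarith)]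
  calc S * √(K : ℝ) ≤ ((2 * B * (1 / a + 1 / α') + 4 * E * α') * √(K : ℝ)) * √(K : ℝ) := by
        gcongr; linarith
    _ = _ := by rw [mul_assoc, hqq]

theorem corollary3
    (ℓf₀ ℓf₁ ℓr₀ ℓr₁ : ℝ≥0) (σf σr₀ σr₁ : ℝ) (N : ℕ) (hN : 1 ≤ N) :
    ∃ α₁ α₂ α₃ β' : ℝ, 0 < α₁ ∧ 0 < α₂ ∧ 0 < α₃ ∧ 0 < β' ∧
    ∀ α' : ℝ, 0 < α' → ∀ Δ R : ℝ, ∃ c : ℝ,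
    ∀ (m d₁ d₂ : ℕ) (Ω Ξ Z : Type*)
      [MeasurableSpace Ω] [MeasurableSpace Ξ] [MeasurableSpace Z]
      (μ : Measure Ω) [IsProbabilityMeasure μ]
      (C : Fin m → Measure Ξ) (D : Fin m → Measure Z)
      (f : Fin m → Vec d₂ → Ξ → ℝ) (r : Fin m → Vec d₁ → Z → Vec d₂)
      (ystar : Vec d₁ → Vec d₂) (τ : Fin m → ℕ) (x₀ : Vec d₁) (y₀ : Vec d₂)
      (W : Ω → Draws m Ξ Z),
      1 ≤ m →
      CompositionalAssumptions C D f r ℓf₀ ℓf₁ ℓr₀ ℓr₁ σf σr₀ σr₁ →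
      (∀ x, ystar x ∈ (compositional f r).innerArgmin D x) →
      (∀ x, (compositional f r).objective C ystar x₀ -
        (compositional f r).objective C ystar x ≤ Δ) →
      ‖y₀ - ystar x₀‖ ≤ R →
      (∀ i, 1 ≤ τ i) →
      IsSampling μ C D N W →
      Differentiable ℝ ((compositional f r).objective C ystar) ∧
      ∀ K : ℕ, 1 ≤ K → ∀ α β : ℝ,
        α = min (min α₁ (min α₂ α₃)) (α' / √(K : ℝ)) →
        β = β' * α →
        (∀ k ∈ Finset.Icc 1 K, Integrable (fun ω =>
          ‖gradient ((compositional f r).objective C ystar)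
            (fedNest (compositional f r) 1 N 1 τ (fun _ i => α / τ i) (fun _ i => β / τ i)
              x₀ y₀ (W ω) k).1‖ ^ 2) μ) ∧
        1 / (K : ℝ) * ∑ k ∈ Finset.Icc 1 K, ∫ ω,
          ‖gradient ((compositional f r).objective C ystar)
            (fedNest (compositional f r) 1 N 1 τ (fun _ i => α / τ i) (fun _ i => β / τ i)
              x₀ y₀ (W ω) k).1‖ ^ 2 ∂μ ≤ c / √(K : ℝ) := by
  set M : ℝ := (2 * (ℓr₀ : ℝ) ^ 2 + 2 * σr₁ ^ 2) * (N * (2 * (ℓf₀ : ℝ) ^ 2 + 2 * σf ^ 2)) with hM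
  set C₁ : ℝ := ((ℓr₀ : ℝ) * ℓf₁ + 2 * ℓr₀) ^ 2 / 2 + 2 * ℓr₀ * (ℓr₀ * ℓf₁) + ℓr₁ * M with hC₁
  set C₂ : ℝ := ((ℓr₀ : ℝ) ^ 2 * ℓf₁ + ℓr₁ * ℓf₀ + ℓr₀ ^ 2 + ℓr₁) * M with hC₂
  have hM0 : 0 ≤ M := by positivity
  have hC₁0 : 0 ≤ C₁ := by positivity
  have hC₂0 : 0 ≤ C₂ := by positivity
  clear_value M C₁ C₂
  have hβ' : 0 < 2 * C₁ + 1 := by positivity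
  -- The ratio β/α must be at least 2 C₁ for the contraction, and the extra 1 keeps it positive; the
  -- second threshold forces β ≤ 1, and the others force α ≤ 1.
  refine ⟨1, 1 / (2 * C₁ + 1), 1, 2 * C₁ + 1, one_pos, by positivity, one_pos, hβ', ?_⟩
  intro α' hα' Δ R
  set a : ℝ := min 1 (min (1 / (2 * C₁ + 1)) 1) with ha
  have ha0 : 0 < a := lt_min one_pos (lt_min (by positivity) one_pos)
  set E : ℝ := C₂ + (1 + C₁) * (2 * C₁ + 1) ^ 2 * σr₀ ^ 2 with hE
  have hE0 : 0 ≤ E := by positivity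
  refine ⟨2 * (Δ + R ^ 2) * (1 / a + 1 / α') + 4 * E * α', ?_⟩
  intro m d₁ d₂ Ω Ξ Z _ _ _ μ _ C D f r ystar τ x₀ y₀ W hm h hy hΔ hR hτ hW
  have hS := h.smoothComposition hm
  rw [h.objective_eq hm hy] at hΔ ⊢
  rw [h.eq_meanInner_of_mem_innerArgmin hm (hy x₀)] at hR
  refine ⟨hS.differentiable_comp, fun K hK α β hα hβ => ?_⟩
  have hα0 : 0 < α := hα ▸ lt_min ha0 (div_pos hα' (Real.sqrt_pos.2 (by exact_mod_cast hK)))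
  have hαa : α ≤ a := hα ▸ min_le_left _ _
  have hα1 : α ≤ 1 := hαa.trans (min_le_left _ _)
  have hβ2 : β = 2 * C₁ * α + α := by rw [hβ]; ring
  have hβ0 : 0 ≤ β := by rw [hβ]; positivity
  have hβ1 : β ≤ 1 := by
    have : α ≤ 1 / (2 * C₁ + 1) := hαa.trans ((min_le_right _ _).trans (min_le_left _ _))
    rw [hβ, mul_comm]
    exact (le_div_iff₀ hβ').1 this
  simp only [fedNest_eq_run hm τ hτ]
  set s := effectiveStep τ fun i => β / τ i
  set G : ℕ → Ω → ℝ := fun k ω => ‖gradient (fun x => meanOuter C f (meanInner D r x))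
    (run f r N s α x₀ y₀ W k ω).1‖ ^ 2 with hG
  -- The gradient of F ∘ ρ is bounded by ℓr₀ ℓf₀, so integrability needs no moment bound on the
  -- iterates.
  have hint : ∀ k, Integrable (G k) μ := fun k => by
    have hmeas : Measurable (G k) := (hS.continuous_gradient_comp.measurable.comp
      (measurable_fst.comp ((h.measurable_run k).mono (hW.sigmaOf_le _) le_rfl))).norm.pow_const 2
    refine Integrable.of_bound hmeas.aestronglyMeasurable (((ℓr₀ : ℝ) * ℓf₀) ^ 2)
      (.of_forall fun ω => ?_)
    rw [Real.norm_of_nonneg (by positivity)]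
    exact pow_le_pow_left₀ (norm_nonneg _) (hS.norm_gradient_comp_le _) 2
  have hG0 : ∀ k, 0 ≤ ∫ ω, G k ω ∂μ := fun k => integral_nonneg fun ω => by positivity
  refine ⟨fun k _ => hint k, ?_⟩
  have hΔ0 : 0 ≤ Δ := by simpa using hΔ x₀
  refine rate_of_min_step ha0 hα' hK hα (by positivity) hE0 ?_
  -- The average runs over x¹, …, x^K while the telescoped sum starts at x⁰, so K + 1 rounds are
  -- used and the term at 0 is dropped below. The lower bound f(x⁰) - Δ makes the initial Lyapunov
  -- value at most Δ + R².
  have hsum := h.sum_lintegral_run_le (x₀ := x₀) (y₀ := y₀) hm hN hW (K + 1) hM.ge hC₁.ge hC₂.ge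
    hC₁0 hC₂0 hα0.le hα1 hβ1 (by linarith) (effectiveStep_mem hm τ hτ hβ0 hβ1)
    (flow := meanOuter C f (meanInner D r x₀) - Δ) (fun x' => by linarith [hΔ x'])
  have e : ∀ k, ∫⁻ ω, ENNReal.ofReal (α / 2 *
        ‖gradient (fun x => meanOuter C f (meanInner D r x))
          (run f r N s α x₀ y₀ W k ω).1‖ ^ 2) ∂μ = ENNReal.ofReal (α / 2 * ∫ ω, G k ω ∂μ) :=
    fun k => by
      rw [← integral_const_mul, ofReal_integral_eq_lintegral_ofReal ((hint k).const_mul _)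
        (.of_forall fun ω => by positivity)]
  simp only [s, e] at hsum
  have hR2 : ‖y₀ - meanInner D r x₀‖ ^ 2 ≤ R ^ 2 := pow_le_pow_left₀ (norm_nonneg _) hR 2
  rw [← ENNReal.ofReal_sum_of_nonneg fun k _ => mul_nonneg (by positivity) (hG0 k),
    ENNReal.ofReal_le_ofReal_iff (by
      have : 0 ≤ C₂ * α ^ 2 + (1 + C₁) * β ^ 2 * σr₀ ^ 2 := by positivity
      rw [sub_sub_cancel]
      positivity), ← Finset.mul_sum] at hsum
  have hsub : ∑ k ∈ Finset.Icc 1 K, ∫ ω, G k ω ∂μ ≤ ∑ k ∈ Finset.range (K + 1), ∫ ω, G k ω ∂μ :=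
    Finset.sum_le_sum_of_subset_of_nonneg (fun k hk => by
      rw [Finset.mem_Icc] at hk; rw [Finset.mem_range]; omega) fun k _ _ => hG0 k
  refine (mul_le_mul_of_nonneg_left hsub (by positivity)).trans (hsum.trans ?_)
  have hEα : C₂ * α ^ 2 + (1 + C₁) * β ^ 2 * σr₀ ^ 2 = E * α ^ 2 := by rw [hβ, hE]; ring
  rw [hEα, sub_sub_cancel]
  push_cast
  linarith

end
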